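/- Write $e(x) = \exp(2\pi i x)$. Let $a < b$ be real numbers and let $f : [a,b] \to \mathbb{R}$ be three times differentiable (one-sided at the endpoints). Suppose that $f'$ is decreasing on $[a,b]$, put $\alpha = f'(b)$ and $\beta = f'(a)$, and suppose that there are real numbers $\lambda_2 > 0$, $\lambda_3 \ge 0$, $h_2$, $h_3$ such that $$\lambda_2 \le |f''(x)| \le h_2 \lambda_2, \qquad |f'''(x)| \le h_3 \lambda_3 \qquad (a \le x \le b).$$ Then for every integer $\nu$ with $\alpha < \nu \le \beta$ there is exactly one $x_\nu \in [a,b]$ with $f'(x_\nu) = \nu$, and $$\left|\sum_{a < n \le b} e(f(n)) - \sum_{\alpha < \nu \le \beta} \frac{e(f(x_\nu) - \nu x_\nu - 1/8)}{|f''(x_\nu)|^{1/2}}\right| \le \frac{4.686}{\sqrt{\lambda_2}} + \frac{2\cdot 3^{2/3}}{\pi^{2/3}} h_2 h_3^{1/3} (b-a) \lambda_3^{1/3} + \frac{5}{\pi}\log(\beta - \alpha + 2) + 6,$$ where $n$ and $\nu$ run over the integers. -/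

import Mathlib

open Real Set

/-- The additive character `e(x) = exp(2πix)`. -/
noncomputable def eChar (x : ℝ) : ℂ := Complex.exp (2 * π * Complex.I * x)

/-! The sum is converted by Poisson summation into the integrals of `e(f(x) - νx)`, and stationary
phase evaluates those whose frequency `ν` is a value of `f'`.

Poisson summation. Euler-Maclaurin writes the sum as `∫ e(f)`, plus the integral of the sawtooth
against `(e ∘ f)'`, plus endpoint terms of total size at most 1. The Fourier series of the sawtooth
makes the second integral a limit of symmetric sums of `poissonTerm` (`tendsto_sum_poissonTerm`).
For a frequency outside the range of `f'`, the endpoint terms of the first derivative test nearly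
cancel those in `poissonTerm`: `1/(f' - ν) + 1/ν = f'/(ν(f' - ν))` decays quadratically in `ν`. The
far frequencies therefore add up to harmonic sums, hence to a logarithm
(`norm_sum_eChar_sub_phaseIntegral_le`).

Stationary phase. Up to distance `X` from `x_ν` the phase is compared with its quadratic model, a
Fresnel integral; beyond that the integral is treated by parts. If `|f''| ≥ λ` and `f''` is
Lipschitz with constant `r³`, the errors `r³X²/λ` and `1/(λX)` balance at `X` of order `1/r` and
cost `O(r/λ)` per frequency. There are at most `β - α + 1 ≤ h₂λ₂(b - a) + 1` frequencies, which
gives the second error term with `r³ = h₃λ₃`. Cutting the integrals off at `a` and `b` costs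
`tailBound`, which again sums to logarithms; frequencies within distance 1 of `α` or `β` need the
second derivative test, the source of `λ₂^(-1/2)`.

The theorem reduces to a phase on the whole line with `f'(b)` in `[0, 1)` by extending `f''` as a
constant on each side of `[a, b]` and subtracting `⌊α⌋x`, which does not change `e(f(n))`. -/

lemma norm_eChar (x : ℝ) : ‖eChar x‖ = 1 := by
  have h : (2 * π * Complex.I * x : ℂ) = ((2 * π * x : ℝ) : ℂ) * Complex.I := by
    push_cast; ring
  rw [eChar, h, Complex.norm_exp_ofReal_mul_I]

lemma eChar_add (x y : ℝ) : eChar (x + y) = eChar x * eChar y := by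
  rw [eChar, eChar, eChar, ← Complex.exp_add]
  congr 1
  push_cast
  ring

lemma eChar_int (n : ℤ) : eChar n = 1 := by
  rw [eChar, Complex.exp_eq_one_iff]
  exact ⟨n, by push_cast; ring⟩

lemma eChar_zero : eChar 0 = 1 := by
  simp [eChar]

lemma eChar_sub_int (x : ℝ) (n : ℤ) : eChar (x - n) = eChar x := by
  have h := eChar_add (x - n) n
  rw [eChar_int, mul_one, sub_add_cancel] at h
  exact h.symm

lemma HasDerivAt.eChar {f : ℝ → ℝ} {f' x : ℝ} (hf : HasDerivAt f f' x) :
    HasDerivAt (fun y => eChar (f y)) (2 * π * Complex.I * f' * eChar (f x)) x := by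
  have h := ((hf.ofReal_comp).const_mul (2 * π * Complex.I : ℂ)).cexp
  refine h.congr_deriv ?_
  rw [_root_.eChar]
  ring

lemma continuous_eChar : Continuous eChar := by
  unfold eChar
  fun_prop

/-- A mean value inequality: a bound for the derivative by that of a real function integrates. -/
lemma norm_sub_le_sub_of_norm_deriv_le {E : Type*} [NormedAddCommGroup E] [NormedSpace ℝ E]
    {H H' : ℝ → E} {B B' : ℝ → ℝ} {a b : ℝ} (hab : a ≤ b)
    (hH : ContinuousOn H (Icc a b)) (hB : ContinuousOn B (Icc a b))
    (hH' : ∀ x ∈ Ioo a b, HasDerivAt H (H' x) x) (hB' : ∀ x ∈ Ioo a b, HasDerivAt B (B' x) x)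
    (hle : ∀ x ∈ Ioo a b, ‖H' x‖ ≤ B' x) : ‖H b - H a‖ ≤ B b - B a := by
  rcases hab.eq_or_lt with rfl | hlt
  · simp
  -- No derivative is assumed at `a`, so the inequality is proved on `[c, b]` and `c` tends to `a`.
  have key : ∀ c ∈ Ioo a b, ‖H b - H c‖ ≤ B b - B c := by
    intro c hc
    have hsub : Icc c b ⊆ Icc a b := Icc_subset_Icc_left hc.1.le
    have hmem : ∀ x ∈ Ico c b, x ∈ Ioo a b := fun x hx => ⟨hc.1.trans_le hx.1, hx.2⟩
    exact image_norm_le_of_norm_deriv_right_le_deriv_boundary' (f := fun x => H x - H c)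
      (B := fun x => B x - B c) (f' := H') (B' := B')
      ((hH.mono hsub).sub continuousOn_const)
      (fun x hx => ((hH' x (hmem x hx)).sub_const _).hasDerivWithinAt) (by simp)
      ((hB.mono hsub).sub continuousOn_const)
      (fun x hx => ((hB' x (hmem x hx)).sub_const _).hasDerivWithinAt)
      (fun x hx => hle x (hmem x hx)) (right_mem_Icc.2 hc.2.le)
  have hla : Filter.Tendsto H (nhdsWithin a (Ioo a b)) (nhds (H a)) :=
    (hH a (left_mem_Icc.2 hab)).mono Ioo_subset_Icc_self
  have hlb : Filter.Tendsto B (nhdsWithin a (Ioo a b)) (nhds (B a)) :=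
    (hB a (left_mem_Icc.2 hab)).mono Ioo_subset_Icc_self
  have : (nhdsWithin a (Ioo a b)).NeBot := by
    rw [nhdsWithin_Ioo_eq_nhdsGT hlt]; infer_instance
  exact le_of_tendsto_of_tendsto (tendsto_const_nhds.sub hla).norm (tendsto_const_nhds.sub hlb)
    (Filter.eventually_of_mem self_mem_nhdsWithin key)

lemma norm_eChar_sub_le (x y : ℝ) : ‖eChar x - eChar y‖ ≤ 2 * π * |x - y| := by
  wlog h : y ≤ x generalizing x y
  · rw [norm_sub_rev, abs_sub_comm]
    exact this y x (le_of_not_ge h)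
  rw [abs_of_nonneg (sub_nonneg.2 h), mul_sub]
  refine norm_sub_le_sub_of_norm_deriv_le (H := eChar) (B := fun z => 2 * π * z)
    (H' := fun z => 2 * π * Complex.I * (1 : ℝ) * eChar z)
    (B' := fun _ => 2 * π) h continuous_eChar.continuousOn (by fun_prop)
    (fun z _ => (hasDerivAt_id z).eChar) (fun z _ => ?_) (fun z _ => ?_)
  · simpa using (hasDerivAt_id z).const_mul (2 * π)
  · simp [norm_eChar, abs_of_pos pi_pos]

lemma norm_integral_eChar_le (f : ℝ → ℝ) {c d : ℝ} (hcd : c ≤ d) :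
    ‖∫ x in c..d, eChar (f x)‖ ≤ d - c := by
  have h := intervalIntegral.norm_integral_le_of_norm_le_const (C := 1) (a := c) (b := d)
    (f := fun x => eChar (f x)) (fun x _ => (norm_eChar _).le)
  rwa [one_mul, abs_of_nonneg (sub_nonneg.2 hcd)] at h

/-! ### First and second derivative tests -/

section FirstDerivative

variable {f f₁ q : ℝ → ℝ} {c d lam : ℝ}

/-- First derivative test for a concave phase, with the endpoint terms kept. -/
lemma norm_integral_eChar_sub_boundary_le (hf : ∀ x, HasDerivAt f (f₁ x) x)
    (hf₁ : ∀ x, HasDerivAt f₁ (-q x) x) (hq : ∀ x, 0 ≤ q x) (hcd : c ≤ d)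
    (hne : ∀ x ∈ Icc c d, f₁ x ≠ 0) :
    ‖(∫ x in c..d, eChar (f x)) -
        (eChar (f d) / (2 * π * Complex.I * f₁ d) - eChar (f c) / (2 * π * Complex.I * f₁ c))‖ ≤
      1 / (2 * π) * (1 / f₁ d - 1 / f₁ c) := by
  have hcont : Continuous fun x => eChar (f x) :=
    continuous_iff_continuousAt.2 fun x => (hf x).eChar.continuousAt
  -- Integration by parts: since `f'' = -q ≤ 0`, the remaining integrand has norm `(1/(2π))
  -- (1/f')'`, so it integrates to the variation of `1/f'`.
  have hH : ∀ x ∈ Icc c d, HasDerivAt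
      (fun x => (∫ y in c..x, eChar (f y)) - eChar (f x) / (2 * π * Complex.I * f₁ x))
      (-(q x * eChar (f x) / (2 * π * Complex.I * (f₁ x) ^ 2))) x := by
    intro x hx
    have h0 : (f₁ x : ℂ) ≠ 0 := by exact_mod_cast hne x hx
    have hpi : (π : ℂ) ≠ 0 := by exact_mod_cast pi_ne_zero
    have h1 := intervalIntegral.integral_hasDerivAt_right
      (hcont.intervalIntegrable c x) hcont.aestronglyMeasurable.stronglyMeasurableAtFilter
      hcont.continuousAt
    have h2 := (hf x).eChar.div ((hf₁ x).ofReal_comp.const_mul (2 * π * Complex.I : ℂ))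
      (by simp [h0, pi_ne_zero])
    refine (h1.sub h2).congr_deriv ?_
    have hI := Complex.I_ne_zero
    field_simp
    push_cast
    ring
  have hB : ∀ x ∈ Icc c d, HasDerivAt (fun x => 1 / (2 * π) * (1 / f₁ x))
      (1 / (2 * π) * (q x / (f₁ x) ^ 2)) x := by
    intro x hx
    refine (((hasDerivAt_const x (1 : ℝ)).div (hf₁ x) (hne x hx)).const_mul _).congr_deriv ?_
    ring
  have key := norm_sub_le_sub_of_norm_deriv_le hcd
    (fun x hx => (hH x hx).continuousAt.continuousWithinAt)
    (fun x hx => (hB x hx).continuousAt.continuousWithinAt)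
    (fun x hx => hH x (Ioo_subset_Icc_self hx)) (fun x hx => hB x (Ioo_subset_Icc_self hx))
    (fun x _ => by
      simp only [norm_neg, norm_div, norm_mul, norm_eChar, Complex.norm_real, norm_pow,
        Complex.norm_I, Complex.norm_two, norm_eq_abs, sq_abs, abs_of_pos pi_pos, abs_of_nonneg (hq x)]
      apply le_of_eq
      field_simp)
  rw [intervalIntegral.integral_same] at key
  rw [mul_sub]
  refine (congrArg norm ?_).trans_le key
  ring

lemma norm_eChar_div_le (y r : ℝ) :
    ‖eChar y / (2 * π * Complex.I * r)‖ = 1 / (2 * π) * (1 / |r|) := by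
  simp only [norm_div, norm_mul, norm_eChar, Complex.norm_real, Complex.norm_I, Complex.norm_two,
    norm_eq_abs, abs_of_pos pi_pos]
  field_simp

lemma antitone_of_deriv_neg (hf₁ : ∀ x, HasDerivAt f₁ (-q x) x) (hq : ∀ x, 0 ≤ q x) :
    Antitone f₁ :=
  antitone_of_deriv_nonpos (fun x => (hf₁ x).differentiableAt)
    fun x => by rw [(hf₁ x).deriv]; linarith [hq x]

/-- The endpoint term at `c`, where `1/f₁` is smaller, is cancelled by the variation of `1/f₁`; only
twice the term at `d` survives. -/
lemma norm_integral_eChar_le_of_pos (hf : ∀ x, HasDerivAt f (f₁ x) x)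
    (hf₁ : ∀ x, HasDerivAt f₁ (-q x) x) (hq : ∀ x, 0 ≤ q x) (hcd : c ≤ d) (hd : 0 < f₁ d) :
    ‖∫ x in c..d, eChar (f x)‖ ≤ 1 / (π * f₁ d) := by
  have hanti := antitone_of_deriv_neg hf₁ hq
  have hpos : ∀ x ∈ Icc c d, 0 < f₁ x := fun x hx => hd.trans_le (hanti hx.2)
  have h := norm_integral_eChar_sub_boundary_le hf hf₁ hq hcd fun x hx => (hpos x hx).ne'
  have h1 := norm_le_norm_add_norm_sub' (∫ x in c..d, eChar (f x))
    (eChar (f d) / (2 * π * Complex.I * f₁ d) - eChar (f c) / (2 * π * Complex.I * f₁ c))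
  have h2 := norm_sub_le (eChar (f d) / (2 * π * Complex.I * f₁ d))
    (eChar (f c) / (2 * π * Complex.I * f₁ c))
  rw [norm_eChar_div_le, norm_eChar_div_le, abs_of_pos hd,
    abs_of_pos (hpos c (left_mem_Icc.2 hcd))] at h2
  have h3 : 1 / (π * f₁ d) = 2 * (1 / (2 * π) * (1 / f₁ d)) := by field_simp
  rw [h3]
  linarith

lemma norm_integral_eChar_le_of_neg (hf : ∀ x, HasDerivAt f (f₁ x) x)
    (hf₁ : ∀ x, HasDerivAt f₁ (-q x) x) (hq : ∀ x, 0 ≤ q x) (hcd : c ≤ d) (hc : f₁ c < 0) :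
    ‖∫ x in c..d, eChar (f x)‖ ≤ 1 / (π * (-f₁ c)) := by
  have hanti := antitone_of_deriv_neg hf₁ hq
  have hneg : ∀ x ∈ Icc c d, f₁ x < 0 := fun x hx => (hanti hx.1).trans_lt hc
  have h := norm_integral_eChar_sub_boundary_le hf hf₁ hq hcd fun x hx => (hneg x hx).ne
  have h1 := norm_le_norm_add_norm_sub' (∫ x in c..d, eChar (f x))
    (eChar (f d) / (2 * π * Complex.I * f₁ d) - eChar (f c) / (2 * π * Complex.I * f₁ c))
  have h2 := norm_sub_le (eChar (f d) / (2 * π * Complex.I * f₁ d))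
    (eChar (f c) / (2 * π * Complex.I * f₁ c))
  rw [norm_eChar_div_le, norm_eChar_div_le, abs_of_neg hc,
    abs_of_neg (hneg d (right_mem_Icc.2 hcd)), div_neg, div_neg] at h2
  have h3 : 1 / (π * (-f₁ c)) = 2 * (1 / (2 * π) * -(1 / f₁ c)) := by
    rw [← div_neg]; field_simp
  rw [h3]
  linarith

lemma sub_ge_of_deriv_le (hf₁ : ∀ x, HasDerivAt f₁ (-q x) x) (hq : ∀ x, lam ≤ q x) {x y : ℝ}
    (hxy : x ≤ y) : lam * (y - x) ≤ f₁ x - f₁ y := by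
  have h : Antitone fun z => f₁ z + lam * z := by
    refine antitone_of_deriv_neg (q := fun z => q z - lam) (fun z => ?_)
      fun z => sub_nonneg.2 (hq z)
    refine ((hf₁ z).add ((hasDerivAt_id z).const_mul lam)).congr_deriv ?_
    ring
  have := h hxy
  simp only at this
  linarith

lemma inv_sqrt_mul_self_add {lam : ℝ} (hlam : 0 < lam) :
    1 / √(π * lam) + 1 / (π * (lam * (1 / √(π * lam)))) = 2 / √(π * lam) := by
  have h1 : 0 < √(π * lam) := sqrt_pos.2 (by positivity)
  have h2 : π * (lam * (1 / √(π * lam))) = √(π * lam) := by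
    rw [← mul_assoc, mul_one_div, div_eq_iff h1.ne', mul_self_sqrt (by positivity)]
  rw [h2]; ring

/-- One-sided second derivative test, the derivative being nonpositive. -/
lemma norm_integral_eChar_le_of_nonpos (hf : ∀ x, HasDerivAt f (f₁ x) x)
    (hf₁ : ∀ x, HasDerivAt f₁ (-q x) x) (hlam : 0 < lam) (hq : ∀ x, lam ≤ q x) (hcd : c ≤ d)
    (hc : f₁ c ≤ 0) : ‖∫ x in c..d, eChar (f x)‖ ≤ 2 / √(π * lam) := by
  have hcont : Continuous fun x => eChar (f x) :=
    continuous_iff_continuousAt.2 fun x => (hf x).eChar.continuousAt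
  rw [← inv_sqrt_mul_self_add hlam]
  have hpos : 0 < √(π * lam) := sqrt_pos.2 (by positivity)
  -- The trivial bound `δ` on the first stretch balances the first derivative bound `1/(πλδ)` on the
  -- rest.
  set δ := 1 / √(π * lam) with hδ
  have hδ0 : 0 < δ := by positivity
  have hT : 0 < 1 / (π * (lam * δ)) := by positivity
  rcases le_total d (c + δ) with h | h
  · linarith [norm_integral_eChar_le f hcd]
  · rw [← intervalIntegral.integral_add_adjacent_intervals (hcont.intervalIntegrable c (c + δ))
      (hcont.intervalIntegrable (c + δ) d)]
    have h1 := norm_integral_eChar_le f (show c ≤ c + δ by linarith)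
    have h2 := sub_ge_of_deriv_le hf₁ hq (show c ≤ c + δ by linarith)
    have h3 : lam * δ ≤ -f₁ (c + δ) := by
      rw [add_sub_cancel_left] at h2; linarith
    have h4 : 0 < lam * δ := by positivity
    have h5 := norm_integral_eChar_le_of_neg hf hf₁ (fun x => hlam.le.trans (hq x)) h
      (by linarith)
    have h6 : 1 / (π * (-f₁ (c + δ))) ≤ 1 / (π * (lam * δ)) := by gcongr
    refine (norm_add_le _ _).trans ?_
    linarith

/-- One-sided second derivative test, the derivative being nonnegative. -/
lemma norm_integral_eChar_le_of_nonneg (hf : ∀ x, HasDerivAt f (f₁ x) x)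
    (hf₁ : ∀ x, HasDerivAt f₁ (-q x) x) (hlam : 0 < lam) (hq : ∀ x, lam ≤ q x) (hcd : c ≤ d)
    (hd : 0 ≤ f₁ d) : ‖∫ x in c..d, eChar (f x)‖ ≤ 2 / √(π * lam) := by
  have h := norm_integral_eChar_le_of_nonpos (f := fun x => f (-x)) (f₁ := fun x => -f₁ (-x))
    (q := fun x => q (-x)) (c := -d) (d := -c) (lam := lam)
    (fun x => by
      refine ((hf (-x)).comp x (hasDerivAt_neg x)).congr_deriv ?_
      ring)
    (fun x => by
      refine ((hf₁ (-x)).comp x (hasDerivAt_neg x)).neg.congr_deriv ?_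
      ring) hlam (fun x => hq (-x)) (by linarith) (by simpa using hd)
  rw [intervalIntegral.integral_comp_neg fun x => eChar (f x)] at h
  simpa using h

end FirstDerivative

/-! ### Truncated Gaussian and Fresnel integrals -/

/-- The partial Gaussian integral up to an error term, for a complex parameter. -/
lemma norm_integral_gaussian_sub_le {b : ℂ} (hb : 0 < b.re) {X : ℝ} (hX : 0 < X) :
    ‖(∫ x in (0 : ℝ)..X, Complex.exp (-b * (x : ℂ) ^ 2)) - (π / b : ℂ) ^ (1 / 2 : ℂ) / 2 +
      Complex.exp (-b * (X : ℂ) ^ 2) / (2 * b * X)‖ ≤ 1 / (2 * ‖b‖ * X) := by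
  have hb0 : b ≠ 0 := by rintro rfl; simp at hb
  have hint := integrable_cexp_neg_mul_sq hb
  have hsplit : (∫ x in (0 : ℝ)..X, Complex.exp (-b * (x : ℂ) ^ 2)) - (π / b : ℂ) ^ (1 / 2 : ℂ) / 2 =
      -∫ x in Ioi X, Complex.exp (-b * (x : ℂ) ^ 2) := by
    rw [← integral_gaussian_complex_Ioi hb,
      ← intervalIntegral.integral_Ioi_sub_Ioi hint.integrableOn hX.le]
    ring
  have hnorm : ∀ x : ℝ, ‖Complex.exp (-b * (x : ℂ) ^ 2)‖ ≤ 1 := by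
    intro x
    have h : (-b * (x : ℂ) ^ 2).re = -b.re * x ^ 2 := by
      rw [← Complex.ofReal_pow, Complex.re_mul_ofReal, Complex.neg_re]
    rw [Complex.norm_exp, h]
    exact Real.exp_le_one_iff.2 (by nlinarith [sq_nonneg x])
  have hcont : Continuous fun x : ℝ => Complex.exp (-b * (x : ℂ) ^ 2) := by fun_prop
  have hrpow : MeasureTheory.IntegrableOn (fun x : ℝ => x ^ (-2 : ℝ)) (Ioi X) :=
    integrableOn_Ioi_rpow_of_lt (by norm_num) hX
  have hbound : ∀ x ∈ Ioi X, ‖Complex.exp (-b * (x : ℂ) ^ 2) / (2 * b * (x : ℂ) ^ 2)‖ ≤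
      1 / (2 * ‖b‖) * x ^ (-2 : ℝ) := by
    intro x hx
    have hx0 : 0 < x := hX.trans hx
    have h2 : x ^ (-2 : ℝ) = 1 / x ^ 2 := by
      rw [rpow_neg hx0.le, rpow_two, one_div]
    have hb' : 0 < ‖b‖ := norm_pos_iff.2 hb0
    rw [norm_div, norm_mul, norm_mul, norm_pow, Complex.norm_real, Complex.norm_two, norm_eq_abs,
      sq_abs, h2, div_mul_div_comm, one_mul]
    gcongr
    exact hnorm x
  have hint2 : MeasureTheory.IntegrableOn
      (fun x : ℝ => Complex.exp (-b * (x : ℂ) ^ 2) / (2 * b * (x : ℂ) ^ 2)) (Ioi X) := by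
    refine MeasureTheory.Integrable.mono' (hrpow.const_mul (1 / (2 * ‖b‖))) ?_
      ((MeasureTheory.ae_restrict_iff' measurableSet_Ioi).2 (Filter.Eventually.of_forall hbound))
    refine Measurable.aestronglyMeasurable ?_
    fun_prop
  -- Integration by parts of the tail leaves an integrand of size at most `1/(2|b|x²)`. The
  -- resulting bound involves only `‖b‖`, so it survives `Re b → 0`.
  have hderiv : ∀ x ∈ Ioi X, HasDerivAt
      (fun x : ℝ => Complex.exp (-b * (x : ℂ) ^ 2) / (2 * b * x))
      (-(Complex.exp (-b * (x : ℂ) ^ 2) + Complex.exp (-b * (x : ℂ) ^ 2) / (2 * b * (x : ℂ) ^ 2)))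
      x := by
    intro x hx
    have hx0 : (x : ℂ) ≠ 0 := by exact_mod_cast (hX.trans hx).ne'
    have h1 : HasDerivAt (fun x : ℝ => (x : ℂ)) 1 x := Complex.ofRealCLM.hasDerivAt
    have h2 := ((h1.pow 2).const_mul (-b)).cexp.div (h1.const_mul (2 * b)) (by simp [hb0, hx0])
    refine h2.congr_deriv ?_
    simp only [Pi.pow_apply]
    field_simp
    ring
  have hlim : Filter.Tendsto (fun x : ℝ => Complex.exp (-b * (x : ℂ) ^ 2) / (2 * b * x))
      Filter.atTop (nhds 0) := by
    refine squeeze_zero_norm' (a := fun x : ℝ => 1 / (2 * ‖b‖) * x⁻¹) ?_ ?_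
    · filter_upwards [Filter.eventually_gt_atTop 0] with x hx
      have hb' : 0 < ‖b‖ := norm_pos_iff.2 hb0
      rw [norm_div, norm_mul, norm_mul, Complex.norm_real, Complex.norm_two, norm_eq_abs,
        abs_of_pos hx, ← div_eq_mul_inv, div_div]
      gcongr
      exact hnorm x
    · simpa using tendsto_inv_atTop_zero.const_mul (1 / (2 * ‖b‖))
  have hX0 : (X : ℂ) ≠ 0 := by exact_mod_cast hX.ne'
  have hcw : ContinuousWithinAt (fun x : ℝ => Complex.exp (-b * (x : ℂ) ^ 2) / (2 * b * x))
      (Ici X) X := by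
    refine ContinuousAt.continuousWithinAt ?_
    exact (hcont.continuousAt).div (by fun_prop) (by simp [hb0, hX0])
  have hFTC := MeasureTheory.integral_Ioi_of_hasDerivAt_of_tendsto hcw hderiv
    (hint.integrableOn.add hint2).neg hlim
  rw [MeasureTheory.integral_neg, MeasureTheory.integral_add hint.integrableOn hint2] at hFTC
  have heq : (∫ x in (0 : ℝ)..X, Complex.exp (-b * (x : ℂ) ^ 2)) - (π / b : ℂ) ^ (1 / 2 : ℂ) / 2 +
      Complex.exp (-b * (X : ℂ) ^ 2) / (2 * b * X) =
      ∫ x in Ioi X, Complex.exp (-b * (x : ℂ) ^ 2) / (2 * b * (x : ℂ) ^ 2) := by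
    rw [hsplit]
    linear_combination hFTC
  rw [heq]
  refine (MeasureTheory.norm_integral_le_of_norm_le (hrpow.const_mul (1 / (2 * ‖b‖)))
    ((MeasureTheory.ae_restrict_iff' measurableSet_Ioi).2
      (Filter.Eventually.of_forall hbound))).trans (le_of_eq ?_)
  rw [MeasureTheory.integral_const_mul, integral_Ioi_rpow_of_lt (by norm_num) hX]
  rw [show (-2 : ℝ) + 1 = -1 by norm_num, rpow_neg_one]
  field_simp

/-- The truncated Fresnel integral. -/
lemma norm_integral_eChar_sq_sub_le {μ X : ℝ} (hμ : 0 < μ) (hX : 0 < X) :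
    ‖(∫ x in (0 : ℝ)..X, eChar (-(μ * x ^ 2 / 2))) - eChar (-(1 / 8)) / (2 * (√μ : ℝ)) +
      eChar (-(μ * X ^ 2 / 2)) / (2 * π * Complex.I * μ * X)‖ ≤ 1 / (2 * π * μ * X) := by
  set b₀ : ℂ := π * μ * Complex.I with hb₀
  have hpi : (π : ℂ) ≠ 0 := by exact_mod_cast pi_ne_zero
  have hμ0 : (μ : ℂ) ≠ 0 := by exact_mod_cast hμ.ne'
  have hX0 : (X : ℂ) ≠ 0 := by exact_mod_cast hX.ne'
  have hb0 : b₀ ≠ 0 := by simp [hb₀, hpi, hμ0]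
  have hexp : ∀ x : ℝ, eChar (-(μ * x ^ 2 / 2)) = Complex.exp (-b₀ * (x : ℂ) ^ 2) := by
    intro x
    rw [eChar, hb₀]
    congr 1
    push_cast
    ring
  have hdiv : (π / b₀ : ℂ) = ((1 / μ : ℝ) : ℂ) * -Complex.I := by
    rw [hb₀]
    push_cast
    field_simp
    simp
  -- The argument of `-i` is `-π/2`; halved, it is `-π/4 = 2π · (-1/8)`, the origin of the `1/8` in
  -- the theorem.
  have hroot : (π / b₀ : ℂ) ^ (1 / 2 : ℂ) = eChar (-(1 / 8)) / (√μ : ℝ) := by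
    have hsq : ((√μ : ℝ) : ℂ) = Complex.exp (((Real.log μ / 2 : ℝ)) : ℂ) := by
      rw [← Complex.ofReal_exp, sqrt_eq_rpow, rpow_def_of_pos hμ]
      congr 3
      ring
    rw [hdiv, Complex.cpow_def_of_ne_zero (by simp [hμ.ne']), Complex.log_ofReal_mul (by positivity)
      (by simp), Complex.log_neg_I, hsq, eChar, ← Complex.exp_sub, one_div μ, Real.log_inv]
    congr 1
    push_cast
    ring
  -- The parameter `b₀` is purely imaginary, so the Gaussian estimate is applied to `b₀ + δ` with `δ
  -- → 0+`; `|b₀ + δ| ≥ πμ` makes the error uniform in `δ`.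
  have hcontb : Filter.Tendsto (fun δ : ℝ =>
      ‖(∫ x in (0 : ℝ)..X, Complex.exp (-(b₀ + δ) * (x : ℂ) ^ 2)) -
        (π / (b₀ + δ) : ℂ) ^ (1 / 2 : ℂ) / 2 +
        Complex.exp (-(b₀ + δ) * (X : ℂ) ^ 2) / (2 * (b₀ + δ) * X)‖) (nhdsWithin 0 (Ioi 0))
      (nhds ‖(∫ x in (0 : ℝ)..X, Complex.exp (-(b₀ + (0 : ℝ)) * (x : ℂ) ^ 2)) -
        (π / (b₀ + (0 : ℝ)) : ℂ) ^ (1 / 2 : ℂ) / 2 +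
        Complex.exp (-(b₀ + (0 : ℝ)) * (X : ℂ) ^ 2) / (2 * (b₀ + (0 : ℝ)) * X)‖) := by
    refine ContinuousAt.continuousWithinAt ?_
    have h1 : Continuous fun δ : ℝ => ∫ x in (0 : ℝ)..X, Complex.exp (-(b₀ + δ) * (x : ℂ) ^ 2) :=
      intervalIntegral.continuous_parametric_intervalIntegral_of_continuous' (by fun_prop) 0 X
    have h2 : ContinuousAt (fun δ : ℝ => (π / (b₀ + δ) : ℂ)) 0 :=
      ContinuousAt.div (by fun_prop) (by fun_prop) (by simpa using hb0)
    have h3 : ContinuousAt (fun δ : ℝ => (π / (b₀ + δ) : ℂ) ^ (1 / 2 : ℂ)) 0 := by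
      refine h2.cpow continuousAt_const ?_
      rw [Complex.ofReal_zero, add_zero, hdiv]
      right
      simp [hμ.ne']
    refine ((h1.continuousAt.sub (h3.div_const 2)).add (ContinuousAt.div ?_ ?_ ?_)).norm
    · fun_prop
    · fun_prop
    · simp [hb0, hX0]
  have hle := le_of_tendsto (b := 1 / (2 * π * μ * X)) hcontb ?_
  · rw [Complex.ofReal_zero, add_zero, hroot] at hle
    simp_rw [hexp]
    rwa [show (2 * π * Complex.I * μ * X : ℂ) = 2 * b₀ * X by rw [hb₀]; ring, mul_comm (2 : ℂ) (√μ : ℝ),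
      ← div_div]
  · filter_upwards [self_mem_nhdsWithin] with δ hδ
    have hδ0 : (0 : ℝ) < δ := hδ
    have hre : (b₀ + δ).re = δ := by simp [hb₀]
    have him : (b₀ + δ).im = π * μ := by simp [hb₀]
    refine (norm_integral_gaussian_sub_le (by rw [hre]; exact hδ0) hX).trans ?_
    have h := Complex.abs_im_le_norm (b₀ + δ)
    rw [him, abs_of_pos (by positivity)] at h
    rw [mul_assoc 2 π μ]
    gcongr

/-! ### One-sided stationary phase -/

section StationaryPhase

variable {f f₁ q : ℝ → ℝ} {lam M L X : ℝ}

lemma abs_deriv_add_mul_le (hf₁ : ∀ x, HasDerivAt f₁ (-q x) x) (h₁0 : f₁ 0 = 0)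
    (hM : ∀ x, |q x - q 0| ≤ M * |x|) {x : ℝ} (hx : 0 ≤ x) :
    |f₁ x + q 0 * x| ≤ M * x ^ 2 / 2 := by
  have hH : ∀ y, HasDerivAt (fun y => f₁ y + q 0 * y) (-(q y - q 0)) y := fun y => by
    refine ((hf₁ y).add ((hasDerivAt_id y).const_mul (q 0))).congr_deriv ?_
    ring
  have hB : ∀ y, HasDerivAt (fun y : ℝ => M * y ^ 2 / 2) (M * y) y := fun y => by
    refine (((hasDerivAt_pow 2 y).const_mul M).div_const 2).congr_deriv ?_
    norm_num
    ring
  have h := norm_sub_le_sub_of_norm_deriv_le hx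
    (fun y _ => (hH y).continuousAt.continuousWithinAt)
    (fun y _ => (hB y).continuousAt.continuousWithinAt) (fun y _ => hH y) (fun y _ => hB y)
    (fun y hy => by
      rw [norm_neg, norm_eq_abs]
      simpa [abs_of_pos hy.1] using hM y)
  simpa [h₁0] using h

lemma abs_add_sq_le (hf : ∀ x, HasDerivAt f (f₁ x) x)
    (hf₁ : ∀ x, HasDerivAt f₁ (-q x) x) (h0 : f 0 = 0) (h₁0 : f₁ 0 = 0)
    (hM : ∀ x, |q x - q 0| ≤ M * |x|) {x : ℝ} (hx : 0 ≤ x) :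
    |f x + q 0 * x ^ 2 / 2| ≤ M * x ^ 3 / 6 := by
  have hH : ∀ y, HasDerivAt (fun y => f y + q 0 * y ^ 2 / 2) (f₁ y + q 0 * y) y := fun y => by
    refine ((hf y).add (((hasDerivAt_pow 2 y).const_mul (q 0)).div_const 2)).congr_deriv ?_
    norm_num
    ring
  have hB : ∀ y, HasDerivAt (fun y : ℝ => M * y ^ 3 / 6) (M * y ^ 2 / 2) y := fun y => by
    refine (((hasDerivAt_pow 3 y).const_mul M).div_const 6).congr_deriv ?_
    norm_num
    ring
  have h := norm_sub_le_sub_of_norm_deriv_le hx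
    (fun y _ => (hH y).continuousAt.continuousWithinAt)
    (fun y _ => (hB y).continuousAt.continuousWithinAt) (fun y _ => hH y) (fun y _ => hB y)
    (fun y hy => abs_deriv_add_mul_le hf₁ h₁0 hM hy.1.le)
  simpa [h0] using h

/-- Comparison of an oscillatory integral near a stationary point with its quadratic model. -/
lemma norm_integral_sub_quadratic_le (hf : ∀ x, HasDerivAt f (f₁ x) x)
    (hf₁ : ∀ x, HasDerivAt f₁ (-q x) x) (h0 : f 0 = 0) (h₁0 : f₁ 0 = 0) (hq0 : 0 < q 0)
    (hM : ∀ x, |q x - q 0| ≤ M * |x|) (hX : 0 < X) :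
    ‖(∫ x in (0 : ℝ)..X, eChar (f x)) - (∫ x in (0 : ℝ)..X, eChar (-(q 0 * x ^ 2 / 2))) +
      (eChar (f X) - eChar (-(q 0 * X ^ 2 / 2))) / (2 * π * Complex.I * q 0 * X)‖ ≤
      M * X ^ 2 / (3 * q 0) := by
  have hg : ∀ x, HasDerivAt (fun x : ℝ => -(q 0 * x ^ 2 / 2)) (-(q 0 * x)) x := fun x => by
    refine (((hasDerivAt_pow 2 x).const_mul (q 0)).div_const 2).neg.congr_deriv ?_
    norm_num
    ring
  have hcf : Continuous fun x => eChar (f x) :=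
    continuous_iff_continuousAt.2 fun x => (hf x).eChar.continuousAt
  have hcg : Continuous fun x : ℝ => eChar (-(q 0 * x ^ 2 / 2)) :=
    continuous_iff_continuousAt.2 fun x => (hg x).eChar.continuousAt
  have hdiff : ∀ x, 0 ≤ x → ‖eChar (f x) - eChar (-(q 0 * x ^ 2 / 2))‖ ≤ 2 * π * (M * x ^ 3 / 6) := by
    intro x hx
    refine (norm_eChar_sub_le _ _).trans ?_
    rw [sub_neg_eq_add]
    gcongr
    exact abs_add_sq_le hf hf₁ h0 h₁0 hM hx
  have hpi : (π : ℂ) ≠ 0 := by exact_mod_cast pi_ne_zero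
  have hq0' : (q 0 : ℂ) ≠ 0 := by exact_mod_cast hq0.ne'
  have hnorm : ∀ x : ℝ, 0 < x → ‖(2 * π * Complex.I * q 0 * x : ℂ)‖ = 2 * π * q 0 * x := by
    intro x hx
    simp [abs_of_pos hx, abs_of_pos hq0, abs_of_pos pi_pos]
  set H : ℝ → ℂ := fun x => (∫ y in (0 : ℝ)..x, eChar (f y)) -
    (∫ y in (0 : ℝ)..x, eChar (-(q 0 * y ^ 2 / 2))) +
      (eChar (f x) - eChar (-(q 0 * x ^ 2 / 2))) / (2 * π * Complex.I * q 0 * x) with hHdef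
  have hint : ∀ x, HasDerivAt (fun x => (∫ y in (0 : ℝ)..x, eChar (f y)) -
      (∫ y in (0 : ℝ)..x, eChar (-(q 0 * y ^ 2 / 2))))
      (eChar (f x) - eChar (-(q 0 * x ^ 2 / 2))) x := fun x =>
    (intervalIntegral.integral_hasDerivAt_right (hcf.intervalIntegrable 0 x)
      hcf.aestronglyMeasurable.stronglyMeasurableAtFilter hcf.continuousAt).sub
    (intervalIntegral.integral_hasDerivAt_right (hcg.intervalIntegrable 0 x)
      hcg.aestronglyMeasurable.stronglyMeasurableAtFilter hcg.continuousAt)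
  -- The correction in `H` is chosen so that the two occurrences of the quadratic exponential
  -- without a factor `1/x²` cancel. By the Taylor bounds, the two terms left are at most
  -- `Mx/(2q(0))` and `Mx/(6q(0))`.
  have hH : ∀ x, 0 < x → HasDerivAt H (eChar (f x) * ((f₁ x + q 0 * x : ℝ) : ℂ) / (q 0 * x) -
      (eChar (f x) - eChar (-(q 0 * x ^ 2 / 2))) / (2 * π * Complex.I * q 0 * x ^ 2)) x := by
    intro x hx
    have hx0 : (x : ℂ) ≠ 0 := by exact_mod_cast hx.ne'
    have hI := Complex.I_ne_zero
    have h1 : HasDerivAt (fun x : ℝ => (x : ℂ)) 1 x := Complex.ofRealCLM.hasDerivAt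
    have h2 := ((hf x).eChar.sub (hg x).eChar).div (h1.const_mul (2 * π * Complex.I * q 0 : ℂ))
      (by simp [hpi, hq0', hx0])
    refine ((hint x).add h2).congr_deriv ?_
    simp only [Pi.sub_apply]
    field_simp
    push_cast
    ring
  have hB : ∀ x, HasDerivAt (fun x : ℝ => M * x ^ 2 / (3 * q 0)) (2 * M * x / (3 * q 0)) x :=
    fun x => by
    refine (((hasDerivAt_pow 2 x).const_mul M).div_const _).congr_deriv ?_
    norm_num
    ring
  have hcont : ContinuousOn H (Icc 0 X) := by
    intro x hx
    rcases hx.1.eq_or_lt with rfl | hx0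
    · refine (hint 0).continuousAt.continuousWithinAt.add ?_
      -- At `0` the quotient is `0` by the convention for division; this is its limit, as the
      -- numerator is `O(x³)`.
      rw [ContinuousWithinAt, Complex.ofReal_zero, mul_zero, div_zero]
      have hlim : Filter.Tendsto (fun x : ℝ => M * x ^ 2 / (6 * q 0)) (nhdsWithin 0 (Icc 0 X))
          (nhds 0) := by
        have : Continuous fun x : ℝ => M * x ^ 2 / (6 * q 0) := by fun_prop
        have h := this.continuousWithinAt (s := Icc 0 X) (x := 0)
        rw [ContinuousWithinAt] at h
        simpa using h
      refine squeeze_zero_norm' ?_ hlim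
      filter_upwards [self_mem_nhdsWithin] with y hy
      rcases hy.1.eq_or_lt with rfl | hy0
      · simp
      · rw [norm_div, hnorm y hy0, div_le_div_iff₀ (by positivity) (by positivity)]
        have := hdiff y hy.1
        calc _ ≤ 2 * π * (M * y ^ 3 / 6) * (6 * q 0) := by gcongr
          _ = _ := by ring
    · exact (hH x hx0).continuousAt.continuousWithinAt
  have key := norm_sub_le_sub_of_norm_deriv_le hX.le hcont
    (fun x _ => (hB x).continuousAt.continuousWithinAt) (fun x hx => hH x hx.1)
    (fun x _ => hB x) (fun x hx => ?_)
  · have hH0 : H 0 = 0 := by simp [hHdef]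
    rw [hH0] at key
    simpa using key
  · have hx0 : 0 < x := hx.1
    have e1 : ‖eChar (f x) * ((f₁ x + q 0 * x : ℝ) : ℂ) / (q 0 * x)‖ ≤ M * x ^ 2 / 2 / (q 0 * x) := by
      rw [norm_div, norm_mul, norm_eChar, one_mul, Complex.norm_real, norm_eq_abs, norm_mul,
        Complex.norm_real, Complex.norm_real, norm_eq_abs (q 0), norm_eq_abs x, abs_of_pos hq0,
        abs_of_pos hx0]
      gcongr
      exact abs_deriv_add_mul_le hf₁ h₁0 hM hx0.le
    have e2 : ‖(eChar (f x) - eChar (-(q 0 * x ^ 2 / 2))) / (2 * π * Complex.I * q 0 * x ^ 2)‖ ≤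
        2 * π * (M * x ^ 3 / 6) / (2 * π * q 0 * x ^ 2) := by
      have : ‖(2 * π * Complex.I * q 0 * x ^ 2 : ℂ)‖ = 2 * π * q 0 * x ^ 2 := by
        simp [abs_of_pos hq0, abs_of_pos pi_pos]
      rw [norm_div, this]
      gcongr
      exact hdiff x hx0.le
    refine (norm_sub_le _ _).trans ((add_le_add e1 e2).trans (le_of_eq ?_))
    field_simp
    ring

/-- One-sided stationary phase with an explicit error term. -/
lemma norm_integral_eChar_sub_half_le (hf : ∀ x, HasDerivAt f (f₁ x) x)
    (hf₁ : ∀ x, HasDerivAt f₁ (-q x) x) (h0 : f 0 = 0) (h₁0 : f₁ 0 = 0) (hlam : 0 < lam)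
    (hq : ∀ x, lam ≤ q x) (hM0 : 0 ≤ M) (hM : ∀ x, |q x - q 0| ≤ M * |x|)
    (hX : 0 < X) (hXL : X ≤ L) :
    ‖(∫ x in (0 : ℝ)..L, eChar (f x)) - eChar (-(1 / 8)) / (2 * (√(q 0) : ℝ))‖ ≤
      M * X ^ 2 / (3 * lam) + 1 / (π * lam * X) := by
  have hq0 : 0 < q 0 := hlam.trans_le (hq 0)
  have hcf : Continuous fun x => eChar (f x) :=
    continuous_iff_continuousAt.2 fun x => (hf x).eChar.continuousAt
  have hdec : ∀ x, 0 < x → lam * x ≤ -f₁ x := fun x hx => by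
    have := sub_ge_of_deriv_le hf₁ hq hx.le
    rw [h₁0] at this; linarith
  have hneg : ∀ x ∈ Icc X L, f₁ x < 0 := fun x hx => by
    have h1 := hdec x (hX.trans_le hx.1)
    have : 0 < lam * x := mul_pos hlam (hX.trans_le hx.1)
    linarith
  have near := norm_integral_sub_quadratic_le hf hf₁ h0 h₁0 hq0 hM hX
  have fres := norm_integral_eChar_sq_sub_le hq0 hX
  have far := norm_integral_eChar_sub_boundary_le hf hf₁ (fun x => hlam.le.trans (hq x)) hXL
    fun x hx => (hneg x hx).ne
  have hfX := hneg X (left_mem_Icc.2 hXL)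
  have hfL := hneg L (right_mem_Icc.2 hXL)
  have hsplit := intervalIntegral.integral_add_adjacent_intervals (hcf.intervalIntegrable 0 X)
      (hcf.intervalIntegrable X L) (μ := MeasureTheory.volume)
  set A := (∫ x in (0 : ℝ)..X, eChar (f x)) - (∫ x in (0 : ℝ)..X, eChar (-(q 0 * x ^ 2 / 2))) +
      (eChar (f X) - eChar (-(q 0 * X ^ 2 / 2))) / (2 * π * Complex.I * q 0 * X) with hA
  set B := (∫ x in (0 : ℝ)..X, eChar (-(q 0 * x ^ 2 / 2))) - eChar (-(1 / 8)) / (2 * (√(q 0) : ℝ)) +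
      eChar (-(q 0 * X ^ 2 / 2)) / (2 * π * Complex.I * q 0 * X) with hB
  set C := (∫ x in X..L, eChar (f x)) - (eChar (f L) / (2 * π * Complex.I * f₁ L) -
    eChar (f X) / (2 * π * Complex.I * f₁ X)) with hC
  -- The quadratic endpoint terms at `X` cancel between `A` and `B`; what remains at `X` is the
  -- discrepancy between `1/(q(0)X)` and `-1/f₁(X)`.
  have heq : (∫ x in (0 : ℝ)..L, eChar (f x)) - eChar (-(1 / 8)) / (2 * (√(q 0) : ℝ)) =
      A + B + C + eChar (f L) / (2 * π * Complex.I * f₁ L) -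
        eChar (f X) / (2 * π * Complex.I) * ((1 / (q 0 * X) + 1 / f₁ X : ℝ) : ℂ) := by
    rw [← hsplit, hA, hB, hC]
    push_cast
    ring
  have hD : ‖eChar (f X) / (2 * π * Complex.I) * ((1 / (q 0 * X) + 1 / f₁ X : ℝ) : ℂ)‖ =
      1 / (2 * π) * |1 / (q 0 * X) + 1 / f₁ X| := by
    simp only [norm_div, norm_mul, norm_eChar, Complex.norm_real, Complex.norm_I, Complex.norm_two,
      norm_eq_abs, abs_of_pos pi_pos, mul_one]
  have hE := norm_eChar_div_le (f L) (f₁ L)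
  rw [abs_of_neg hfL, div_neg] at hE
  rw [heq]
  have htri : ‖A + B + C + eChar (f L) / (2 * π * Complex.I * f₁ L) -
        eChar (f X) / (2 * π * Complex.I) * ((1 / (q 0 * X) + 1 / f₁ X : ℝ) : ℂ)‖ ≤
      ‖A‖ + ‖B‖ + ‖C‖ + ‖eChar (f L) / (2 * π * Complex.I * f₁ L)‖ +
        ‖eChar (f X) / (2 * π * Complex.I) * ((1 / (q 0 * X) + 1 / f₁ X : ℝ) : ℂ)‖ :=
    (norm_sub_le _ _).trans (by gcongr; exact norm_add₄_le)
  refine htri.trans ?_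
  rw [hD, hE]
  have hnear : M * X ^ 2 / (3 * q 0) ≤ M * X ^ 2 / (3 * lam) := by
    have := hq 0
    gcongr
  set u := 1 / (q 0 * X) with hu
  set v := -(1 / f₁ X) with hv
  have hv' : 1 / f₁ X = -v := by rw [hv, neg_neg]
  have hu1 : u ≤ 1 / (lam * X) := by
    have := hq 0
    rw [hu]; gcongr
  have hv1 : v ≤ 1 / (lam * X) := by
    rw [hv, ← div_neg]
    have := hdec X hX
    gcongr
  have hB' : 1 / (2 * π * q 0 * X) = 1 / (2 * π) * u := by
    rw [hu]; field_simp
  rw [hB'] at fres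
  rw [hv'] at far ⊢
  -- The terms at `L` have cancelled, so the bound does not depend on `L`; the rest is `u + v + |u -
  -- v| = 2 max(u, v)`.
  have hfin : u + v + |u + -v| ≤ 2 * (1 / (lam * X)) := by
    rcases abs_cases (u + -v) with h | h <;> linarith
  have hfin2 := mul_le_mul_of_nonneg_left hfin (show 0 ≤ 1 / (2 * π) by positivity)
  have hlast : 1 / (π * lam * X) = 1 / (2 * π) * (2 * (1 / (lam * X))) := by field_simp
  rw [hlast]
  linarith

end StationaryPhase

/-! ### Euler-Maclaurin summation and the sawtooth series -/

/-- Abel summation over the integers of an interval. -/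
lemma sum_Ioc_floor_eq_sub_integral {g g' : ℝ → ℂ} (hg : ∀ x, HasDerivAt g (g' x) x)
    (hg' : Continuous g') {a b : ℝ} (hab : a ≤ b) :
    ∑ n ∈ Finset.Ioc ⌊a⌋ ⌊b⌋, g n = ⌊b⌋ * g b - ⌊a⌋ * g a - ∫ t in a..b, ⌊t⌋ * g' t := by
  -- Translation by `N` makes both endpoints nonnegative, so that summation over natural numbers
  -- applies; its contribution `(N + 1)(g(b) - g(a))` cancels at the end.
  set N : ℕ := (-⌊a⌋).toNat with hN
  have hN' : -⌊a⌋ ≤ (N : ℤ) := Int.self_le_toNat _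
  have haN : 0 ≤ a + N := by
    have h1 := Int.floor_le a
    have h2 : (-⌊a⌋ : ℝ) ≤ N := by exact_mod_cast hN'
    linarith
  have hfl : ∀ x : ℝ, a ≤ x → ((⌊x + N⌋₊ : ℕ) : ℤ) = ⌊x⌋ + N := by
    intro x hx
    rw [Int.natCast_floor_eq_floor (by linarith), Int.floor_add_natCast]
  have hd : ∀ x, HasDerivAt (fun x => g (x - N)) (g' (x - N)) x := fun x => by
    simpa using (hg (x - N)).comp_sub_const x (N : ℝ)
  have hderiv : deriv (fun x => g (x - N)) = fun x => g' (x - N) := funext fun x => (hd x).deriv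
  have hcont : Continuous fun x => g' (x - N) := by fun_prop
  have h := sum_mul_eq_sub_sub_integral_mul (fun _ => (1 : ℂ)) (f := fun x => g (x - N)) haN
    (show a + N ≤ b + N by linarith) (fun t _ => (hd t).differentiableAt)
    (by rw [hderiv]; exact hcont.integrableOn_Icc)
  have hsum : ∑ k ∈ Finset.Ioc ⌊a + N⌋₊ ⌊b + N⌋₊, g ((k : ℝ) - N) * 1 =
      ∑ n ∈ Finset.Ioc ⌊a⌋ ⌊b⌋, g n := by
    refine Finset.sum_bij' (fun k _ => (k : ℤ) - N) (fun n _ => (n + N).toNat) ?_ ?_ ?_ ?_ ?_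
    · intro k hk
      have h1 := hfl a le_rfl
      have h2 := hfl b hab
      rw [Finset.mem_Ioc] at hk ⊢
      omega
    · intro n hn
      have h1 := hfl a le_rfl
      have h2 := hfl b hab
      rw [Finset.mem_Ioc] at hn ⊢
      omega
    · intro k hk
      omega
    · intro n hn
      rw [Finset.mem_Ioc] at hn
      omega
    · intro k hk
      push_cast
      rw [mul_one]
  have hcard : ∀ x : ℝ, a ≤ x → (∑ _k ∈ Finset.Icc 0 ⌊x + N⌋₊, (1 : ℂ)) = ⌊x⌋ + N + 1 := by
    intro x hx
    have h1 : ((⌊x + N⌋₊ : ℤ) : ℂ) = ((⌊x⌋ + N : ℤ) : ℂ) := by rw [hfl x hx]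
    push_cast at h1
    simp [h1]
  rw [hsum, hcard b hab, hcard a le_rfl, hderiv, ← intervalIntegral.integral_of_le (by linarith),
    ← intervalIntegral.integral_comp_add_right
      (fun t => g' (t - N) * ∑ _k ∈ Finset.Icc 0 ⌊t⌋₊, (1 : ℂ))] at h
  have hfm : Measurable fun t : ℝ => ((⌊t⌋ : ℤ) : ℂ) :=
    (measurable_from_top (f := fun n : ℤ => (n : ℂ))).comp Int.measurable_floor
  have hint : IntervalIntegrable (fun t => (⌊t⌋ : ℂ) * g' t) MeasureTheory.volume a b := by
    refine ((hg'.intervalIntegrable a b).norm.const_mul (|(⌊a⌋ : ℝ)| + |(⌊b⌋ : ℝ)|)).mono_fun'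
      (hfm.aestronglyMeasurable.mul hg'.aestronglyMeasurable) ?_
    rw [uIoc_of_le hab]
    refine (MeasureTheory.ae_restrict_iff' measurableSet_Ioc).2 (Filter.Eventually.of_forall ?_)
    intro t ht
    simp only [norm_mul]
    gcongr
    have h1 : (⌊a⌋ : ℝ) ≤ ⌊t⌋ := by exact_mod_cast Int.floor_mono ht.1.le
    have h2 : (⌊t⌋ : ℝ) ≤ ⌊b⌋ := by exact_mod_cast Int.floor_mono ht.2
    rw [Complex.norm_intCast]
    have h3 := neg_abs_le (⌊a⌋ : ℝ)
    have h4 := le_abs_self (⌊b⌋ : ℝ)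
    have h5 := abs_nonneg (⌊a⌋ : ℝ)
    have h6 := abs_nonneg (⌊b⌋ : ℝ)
    rw [abs_le]
    constructor <;> linarith
  have hI : (∫ t in a..b, g' (t + N - N) * ∑ _k ∈ Finset.Icc 0 ⌊t + N⌋₊, (1 : ℂ)) =
      (∫ t in a..b, ⌊t⌋ * g' t) + ((N : ℂ) + 1) * (g b - g a) := by
    rw [← intervalIntegral.integral_eq_sub_of_hasDerivAt (fun x _ => hg x)
      (hg'.intervalIntegrable a b), ← intervalIntegral.integral_const_mul,
      ← intervalIntegral.integral_add hint ((hg'.intervalIntegrable a b).const_mul _)]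
    refine intervalIntegral.integral_congr fun t ht => ?_
    rw [uIcc_of_le hab] at ht
    simp only [hcard t ht.1, add_sub_cancel_right]
    ring
  rw [hI] at h
  simp only [add_sub_cancel_right] at h
  rw [h]
  ring

lemma measurable_fract_sub_half : Measurable fun t : ℝ => ((Int.fract t - 1 / 2 : ℝ) : ℂ) :=
  Complex.measurable_ofReal.comp ((measurable_fract).sub_const _)

lemma intervalIntegrable_fract_sub_half (a b : ℝ) :
    IntervalIntegrable (fun t : ℝ => ((Int.fract t - 1 / 2 : ℝ) : ℂ)) MeasureTheory.volume a b := by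
  refine (intervalIntegrable_const (c := (1 : ℝ))).mono_fun'
    measurable_fract_sub_half.aestronglyMeasurable (Filter.Eventually.of_forall fun t => ?_)
  simp only [Complex.norm_real, norm_eq_abs]
  have h1 := Int.fract_nonneg t
  have h2 := (Int.fract_lt_one t).le
  rw [abs_le]
  constructor <;> linarith

lemma IntervalIntegrable.fract_sub_half_mul {g : ℝ → ℂ} (hg : Continuous g) (a b : ℝ) :
    IntervalIntegrable (fun t : ℝ => ((Int.fract t - 1 / 2 : ℝ) : ℂ) * g t)
      MeasureTheory.volume a b :=
  (intervalIntegrable_fract_sub_half a b).mul_continuousOn hg.continuousOn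

/-- The first Euler-Maclaurin formula. -/
lemma sum_Ioc_floor_eq_integral_add {g g' : ℝ → ℂ} (hg : ∀ x, HasDerivAt g (g' x) x)
    (hg' : Continuous g') {a b : ℝ} (hab : a ≤ b) :
    ∑ n ∈ Finset.Ioc ⌊a⌋ ⌊b⌋, g n = (∫ t in a..b, g t) +
      (∫ t in a..b, ((Int.fract t - 1 / 2 : ℝ) : ℂ) * g' t) -
      ((Int.fract b - 1 / 2 : ℝ) : ℂ) * g b + ((Int.fract a - 1 / 2 : ℝ) : ℂ) * g a := by
  have hlin : ∀ x : ℝ, HasDerivAt (fun t : ℝ => ((t - 1 / 2 : ℝ) : ℂ)) 1 x := fun x => by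
    simpa using ((hasDerivAt_id x).sub_const (1 / 2)).ofReal_comp
  have hparts := intervalIntegral.integral_mul_deriv_eq_deriv_mul (a := a) (b := b)
    (fun x _ => hlin x) (fun x _ => hg x) (intervalIntegrable_const)
    (hg'.intervalIntegrable a b)
  have hdiff : (∫ t in a..b, (⌊t⌋ : ℂ) * g' t) = (∫ t in a..b, ((t - 1 / 2 : ℝ) : ℂ) * g' t) -
      ∫ t in a..b, ((Int.fract t - 1 / 2 : ℝ) : ℂ) * g' t := by
    rw [← intervalIntegral.integral_sub _ (IntervalIntegrable.fract_sub_half_mul hg' a b)]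
    · refine intervalIntegral.integral_congr fun t _ => ?_
      simp only [Int.fract]
      push_cast
      ring
    · exact Continuous.intervalIntegrable (by fun_prop) a b
  rw [sum_Ioc_floor_eq_sub_integral hg hg' hab, hdiff, hparts]
  simp only [one_mul, Int.fract]
  push_cast
  ring

lemma hasSum_cos_div_sq (t : ℝ) :
    HasSum (fun n : ℕ => 1 / (n : ℝ) ^ 2 * Real.cos (2 * π * n * t))
      (π ^ 2 * (Int.fract t ^ 2 - Int.fract t + 1 / 6)) := by
  have h := hasSum_one_div_nat_pow_mul_cos one_ne_zero
    (x := Int.fract t) ⟨Int.fract_nonneg t, (Int.fract_lt_one t).le⟩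
  have hB : Polynomial.eval (Int.fract t)
      (Polynomial.map (algebraMap ℚ ℝ) (Polynomial.bernoulli 2)) =
      Int.fract t ^ 2 - Int.fract t + 1 / 6 := by
    simp [Polynomial.bernoulli, Finset.sum_range_succ, bernoulli_one, bernoulli_two]
    ring
  rw [mul_one, hB] at h
  have hcos : ∀ n : ℕ, Real.cos (2 * π * n * Int.fract t) = Real.cos (2 * π * n * t) := by
    intro n
    have : 2 * π * n * t = 2 * π * n * Int.fract t + ((n * ⌊t⌋ : ℤ) : ℝ) * (2 * π) := by
      rw [Int.fract]; push_cast; ring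
    rw [this, Real.cos_add_int_mul_two_pi]
  simp_rw [hcos] at h
  have hc : (-1 : ℝ) ^ (1 + 1) * (2 * π) ^ 2 / 2 / ((Nat.factorial 2 : ℕ) : ℝ) = π ^ 2 := by
    norm_num [Nat.factorial]
    ring
  rwa [hc] at h

lemma abs_cos_div_sq_le (n : ℕ) (t : ℝ) :
    |1 / (n : ℝ) ^ 2 * Real.cos (2 * π * n * t)| ≤ 1 / (n : ℝ) ^ 2 := by
  rw [abs_mul, abs_of_nonneg (by positivity : (0 : ℝ) ≤ 1 / (n : ℝ) ^ 2)]
  exact mul_le_of_le_one_right (by positivity) (Real.abs_cos_le_one _)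

lemma continuous_fract_sq_sub_fract :
    Continuous fun t : ℝ => π ^ 2 * (Int.fract t ^ 2 - Int.fract t + 1 / 6) := by
  have h : (fun t : ℝ => π ^ 2 * (Int.fract t ^ 2 - Int.fract t + 1 / 6)) =
      fun t => ∑' n : ℕ, 1 / (n : ℝ) ^ 2 * Real.cos (2 * π * n * t) :=
    funext fun t => (hasSum_cos_div_sq t).tsum_eq.symm
  rw [h]
  exact continuous_tsum (fun n => by fun_prop) (Real.summable_one_div_nat_pow.2 one_lt_two)
    fun n t => abs_cos_div_sq_le n t

/-- The Fourier expansion of the sawtooth, integrated against a `C¹` function. -/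
lemma hasSum_integral_sin_mul {g g' : ℝ → ℂ} (hg : ∀ x, HasDerivAt g (g' x) x)
    (hg' : Continuous g') (a b : ℝ) :
    HasSum (fun n : ℕ => -∫ t in a..b, ((Real.sin (2 * π * n * t) / (π * n) : ℝ) : ℂ) * g t)
      (∫ t in a..b, ((Int.fract t - 1 / 2 : ℝ) : ℂ) * g t) := by
  -- The sawtooth series does not converge absolutely. Integration by parts passes to the periodic
  -- quadratic `β`, whose series is dominated by `∑ 1/n²` and may be integrated termwise; each term
  -- is then integrated by parts back.
  set β : ℝ → ℝ := fun t => π ^ 2 * (Int.fract t ^ 2 - Int.fract t + 1 / 6) with hβ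
  have hβc : Continuous β := continuous_fract_sq_sub_fract
  have hgc : Continuous g := continuous_iff_continuousAt.2 fun x => (hg x).continuousAt
  -- At integers `β` has a corner. It is continuous with a right derivative everywhere, which
  -- suffices for integration by parts.
  have hβd : ∀ x, HasDerivWithinAt (fun t => ((β t : ℝ) : ℂ))
      ((2 * π ^ 2 : ℝ) * ((Int.fract x - 1 / 2 : ℝ) : ℂ)) (Ioi x) x := by
    intro x
    have h1 : HasDerivAt (fun t : ℝ => π ^ 2 * ((t - ⌊x⌋) ^ 2 - (t - ⌊x⌋) + 1 / 6))
        (2 * π ^ 2 * (Int.fract x - 1 / 2)) x := by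
      have h0 := (hasDerivAt_id x).sub_const (⌊x⌋ : ℝ)
      refine (((h0.pow 2).sub h0).add_const (1 / 6)).const_mul (π ^ 2) |>.congr_deriv ?_
      simp only [Int.fract, id]
      norm_num
      ring
    have h2 : HasDerivWithinAt β (2 * π ^ 2 * (Int.fract x - 1 / 2)) (Ioi x) x := by
      refine h1.hasDerivWithinAt.congr_of_eventuallyEq ?_ ?_
      · filter_upwards [Ioo_mem_nhdsGT (Int.lt_floor_add_one x)] with y hy
        have : ⌊y⌋ = ⌊x⌋ := Int.floor_eq_iff.2 ⟨(Int.floor_le x).trans hy.1.le, hy.2⟩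
        simp only [hβ, Int.fract, this]
      · simp only [hβ, Int.fract]
    exact (Complex.ofRealCLM.hasFDerivAt.comp_hasDerivWithinAt x h2).congr_deriv (by simp)
  have hparts := intervalIntegral.integral_mul_deriv_eq_deriv_mul_of_hasDeriv_right
    (a := a) (b := b) (Complex.continuous_ofReal.comp hβc).continuousOn hgc.continuousOn
    (fun x _ => hβd x) (fun x _ => (hg x).hasDerivWithinAt)
    ((intervalIntegrable_fract_sub_half a b).const_mul _) (hg'.intervalIntegrable a b)
  have hterm : ∀ n : ℕ, (∫ t in a..b, ((1 / (n : ℝ) ^ 2 * Real.cos (2 * π * n * t) : ℝ) : ℂ) * g' t) =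
      ((1 / (n : ℝ) ^ 2 * Real.cos (2 * π * n * b) : ℝ) : ℂ) * g b -
      ((1 / (n : ℝ) ^ 2 * Real.cos (2 * π * n * a) : ℝ) : ℂ) * g a -
      ∫ t in a..b, ((-(2 * π / n * Real.sin (2 * π * n * t)) : ℝ) : ℂ) * g t := by
    intro n
    refine intervalIntegral.integral_mul_deriv_eq_deriv_mul (fun x _ => ?_) (fun x _ => hg x)
      (Continuous.intervalIntegrable (by fun_prop) a b) (hg'.intervalIntegrable a b)
    have h := (((hasDerivAt_id x).const_mul (2 * π * n)).cos.const_mul (1 / (n : ℝ) ^ 2))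
    refine (h.congr_deriv ?_).ofReal_comp
    rcases Nat.eq_zero_or_pos n with rfl | hn
    · simp
    · have : (n : ℝ) ≠ 0 := by positivity
      simp only [id]
      field_simp
  have hcast : ∀ t, HasSum (fun n : ℕ => ((1 / (n : ℝ) ^ 2 * Real.cos (2 * π * n * t) : ℝ) : ℂ))
      ((β t : ℝ) : ℂ) := fun t => Complex.hasSum_ofReal.2 (hasSum_cos_div_sq t)
  have hsummable : Summable fun n : ℕ => 1 / (n : ℝ) ^ 2 :=
    Real.summable_one_div_nat_pow.2 one_lt_two
  have hintsum : HasSum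
      (fun n : ℕ => ∫ t in a..b, ((1 / (n : ℝ) ^ 2 * Real.cos (2 * π * n * t) : ℝ) : ℂ) * g' t)
      (∫ t in a..b, ((β t : ℝ) : ℂ) * g' t) := by
    refine intervalIntegral.hasSum_integral_of_dominated_convergence
      (fun n t => 1 / (n : ℝ) ^ 2 * ‖g' t‖) (fun n => ?_) (fun n => ?_) ?_ ?_ ?_
    · exact Continuous.aestronglyMeasurable (by fun_prop)
    · refine Filter.Eventually.of_forall fun t _ => ?_
      rw [norm_mul, Complex.norm_real]
      exact mul_le_mul_of_nonneg_right (abs_cos_div_sq_le n t) (norm_nonneg _)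
    · exact Filter.Eventually.of_forall fun t _ => hsummable.mul_right _
    · simp_rw [tsum_mul_right]
      exact (hg'.norm.intervalIntegrable a b).const_mul _
    · exact Filter.Eventually.of_forall fun t _ => (hcast t).mul_right _
  have hall := (((hcast b).mul_right (g b)).sub ((hcast a).mul_right (g a))).sub hintsum
  have hfin := hall.mul_left ((1 / (2 * π ^ 2) : ℝ) : ℂ)
  have hpi : (π : ℂ) ≠ 0 := by exact_mod_cast pi_ne_zero
  have hlim : (∫ t in a..b, ((Int.fract t - 1 / 2 : ℝ) : ℂ) * g t) = ((1 / (2 * π ^ 2) : ℝ) : ℂ) *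
      (β b * g b - β a * g a - ∫ t in a..b, (β t : ℂ) * g' t) := by
    simp only [Function.comp_def] at hparts
    rw [hparts, sub_sub_cancel, ← intervalIntegral.integral_const_mul]
    refine intervalIntegral.integral_congr fun t _ => ?_
    push_cast
    field_simp
  rw [hlim]
  convert! hfin using 2 with n
  rw [hterm n, sub_sub_cancel, ← intervalIntegral.integral_const_mul,
    ← intervalIntegral.integral_neg]
  refine intervalIntegral.integral_congr fun t _ => ?_
  rcases Nat.eq_zero_or_pos n with rfl | hn
  · simp
  · push_cast
    field_simp

/-! ### Poisson summation for `e(f)` -/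

/-- The integral of `e(f(x) - νx)` over `[a, b]`. -/
noncomputable def phaseIntegral (f : ℝ → ℝ) (a b : ℝ) (ν : ℤ) : ℂ :=
  ∫ x in a..b, eChar (f x - ν * x)

/-- The term of frequency `ν ≠ 0` in the Poisson summation formula for `e(f)` on `[a, b]`. -/
noncomputable def poissonTerm (f : ℝ → ℝ) (a b : ℝ) (ν : ℤ) : ℂ :=
  phaseIntegral f a b ν + (eChar (f b - ν * b) - eChar (f a - ν * a)) / (2 * π * Complex.I * ν)

lemma eChar_eq_cos_add_sin (x : ℝ) :
    eChar x = (Real.cos (2 * π * x) : ℝ) + (Real.sin (2 * π * x) : ℝ) * Complex.I := by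
  rw [eChar, Complex.ofReal_cos, Complex.ofReal_sin, ← Complex.exp_mul_I]
  congr 1
  push_cast
  ring

section Poisson

variable {f f₁ q : ℝ → ℝ} {a b : ℝ}

lemma HasDerivAt.sub_int_mul {f : ℝ → ℝ} {f' x : ℝ} (hf : HasDerivAt f f' x) (ν : ℤ) :
    HasDerivAt (fun x => f x - ν * x) (f' - ν) x :=
  (hf.sub ((hasDerivAt_id x).const_mul (ν : ℝ))).congr_deriv (by simp)

/-- Integration by parts moves the derivative onto the sine; the resulting `2 cos` splits into the
frequencies `n` and `-n`, and the sine boundary values are the endpoint terms of `poissonTerm`. -/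
lemma neg_integral_sin_mul_eq (hf : ∀ x, HasDerivAt f (f₁ x) x) (hf₁c : Continuous f₁) {n : ℕ}
    (hn : n ≠ 0) :
    -∫ t in a..b, ((Real.sin (2 * π * n * t) / (π * n) : ℝ) : ℂ) *
        (2 * π * Complex.I * f₁ t * eChar (f t)) =
      poissonTerm f a b n + poissonTerm f a b (-n) := by
  have hfc : Continuous f := continuous_iff_continuousAt.2 fun x => (hf x).continuousAt
  have hec : Continuous fun x => eChar (f x) := continuous_eChar.comp hfc
  have hn0 : (n : ℝ) ≠ 0 := by exact_mod_cast hn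
  have hnC : (n : ℂ) ≠ 0 := by exact_mod_cast hn
  have hpi : (π : ℂ) ≠ 0 := by exact_mod_cast pi_ne_zero
  have hI := Complex.I_ne_zero
  have hu : ∀ x : ℝ, HasDerivAt (fun t : ℝ => ((Real.sin (2 * π * n * t) / (π * n) : ℝ) : ℂ))
      ((2 * Real.cos (2 * π * n * x) : ℝ) : ℂ) x := by
    intro x
    refine ((((hasDerivAt_id x).const_mul (2 * π * n)).sin.div_const (π * n)).congr_deriv
      ?_).ofReal_comp
    simp only [id]
    field_simp
  have hsplit : ∀ (ν : ℤ) (t : ℝ), eChar (f t - ν * t) = eChar (f t) *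
      ((Real.cos (2 * π * ν * t) : ℝ) - (Real.sin (2 * π * ν * t) : ℝ) * Complex.I) := by
    intro ν t
    rw [sub_eq_add_neg, eChar_add, eChar_eq_cos_add_sin (-(ν * t)),
      show 2 * π * (-(ν * t)) = -(2 * π * ν * t) by ring, Real.cos_neg, Real.sin_neg]
    push_cast
    ring
  rw [intervalIntegral.integral_mul_deriv_eq_deriv_mul (fun x _ => hu x)
    (fun x _ => (hf x).eChar) (Continuous.intervalIntegrable (by fun_prop) a b)
    (Continuous.intervalIntegrable (by fun_prop) a b)]
  have hsum : phaseIntegral f a b n + phaseIntegral f a b (-n) =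
      ∫ t in a..b, ((2 * Real.cos (2 * π * n * t) : ℝ) : ℂ) * eChar (f t) := by
    have hJ : ∀ ν : ℤ, Continuous fun x => eChar (f x - ν * x) := fun ν =>
      continuous_eChar.comp (by fun_prop : Continuous fun x => f x - ν * x)
    rw [phaseIntegral, phaseIntegral, ← intervalIntegral.integral_add
      ((hJ _).intervalIntegrable a b) ((hJ _).intervalIntegrable a b)]
    refine intervalIntegral.integral_congr fun t _ => ?_
    rw [hsplit, hsplit]
    push_cast
    rw [show (2 * π * -n * t : ℂ) = -(2 * π * n * t) by ring, Complex.cos_neg, Complex.sin_neg]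
    ring
  rw [poissonTerm, poissonTerm, add_add_add_comm, hsum]
  simp only [hsplit]
  push_cast
  simp only [mul_neg, neg_mul, Complex.cos_neg, Complex.sin_neg]
  field_simp
  ring

/-- Poisson summation on an interval, as a limit of symmetric partial sums. -/
lemma tendsto_sum_poissonTerm (hf : ∀ x, HasDerivAt f (f₁ x) x)
    (hf₁ : ∀ x, HasDerivAt f₁ (-q x) x) (hqc : Continuous q) (a b : ℝ) :
    Filter.Tendsto (fun N : ℕ => ∑ n ∈ Finset.range N,
        (poissonTerm f a b (n + 1 : ℕ) + poissonTerm f a b (-(n + 1 : ℕ)))) Filter.atTop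
      (nhds (∫ t in a..b, ((Int.fract t - 1 / 2 : ℝ) : ℂ) *
        (2 * π * Complex.I * f₁ t * eChar (f t)))) := by
  have hfc : Continuous f := continuous_iff_continuousAt.2 fun x => (hf x).continuousAt
  have hf₁c : Continuous f₁ := continuous_iff_continuousAt.2 fun x => (hf₁ x).continuousAt
  have hec : Continuous fun x => eChar (f x) := continuous_eChar.comp hfc
  have h := hasSum_integral_sin_mul (a := a) (b := b)
    (g := fun t => 2 * π * Complex.I * f₁ t * eChar (f t))
    (fun x => ((hf₁ x).ofReal_comp.const_mul (2 * π * Complex.I : ℂ)).mul (hf x).eChar)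
    (by fun_prop)
  have h1 := h.tendsto_sum_nat.comp (Filter.tendsto_add_atTop_nat 1)
  refine h1.congr fun N => ?_
  simp only [Function.comp_apply]
  -- The term `n = 0` vanishes, since `sin 0 = 0`.
  rw [Finset.sum_range_succ']
  simp only [Nat.cast_zero, mul_zero, zero_mul, Real.sin_zero, zero_div, Complex.ofReal_zero,
    intervalIntegral.integral_zero, neg_zero, add_zero]
  exact Finset.sum_congr rfl fun n _ => neg_integral_sin_mul_eq hf hf₁c n.succ_ne_zero

lemma norm_fract_sub_half_mul_eChar_le (x y : ℝ) :
    ‖((Int.fract x - 1 / 2 : ℝ) : ℂ) * eChar y‖ ≤ 1 / 2 := by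
  rw [norm_mul, norm_eChar, mul_one, Complex.norm_real, norm_eq_abs]
  have h1 := Int.fract_nonneg x
  have h2 := (Int.fract_lt_one x).le
  rw [abs_le]
  constructor <;> linarith

/-- A bound uniform in the partial sums passes to the limit; the two endpoint terms of
Euler-Maclaurin cost `1/2` each. -/
lemma norm_sum_eChar_sub_le_of_poissonTerm (hf : ∀ x, HasDerivAt f (f₁ x) x)
    (hf₁ : ∀ x, HasDerivAt f₁ (-q x) x) (hqc : Continuous q) (hab : a ≤ b) (Z : ℂ) (C : ℝ) (N₀ : ℕ)
    (hZ : ∀ N, ‖(∑ n ∈ Finset.range (N₀ + N),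
      (poissonTerm f a b (n + 1 : ℕ) + poissonTerm f a b (-(n + 1 : ℕ)))) - Z‖ ≤ C) :
    ‖(∑ n ∈ Finset.Ioc ⌊a⌋ ⌊b⌋, eChar (f n)) - (phaseIntegral f a b 0 + Z)‖ ≤ 1 + C := by
  have hfc : Continuous f := continuous_iff_continuousAt.2 fun x => (hf x).continuousAt
  have hf₁c : Continuous f₁ := continuous_iff_continuousAt.2 fun x => (hf₁ x).continuousAt
  have hec : Continuous fun x => eChar (f x) := continuous_eChar.comp hfc
  have hT := (tendsto_sum_poissonTerm hf hf₁ hqc a b).comp (Filter.tendsto_add_atTop_nat N₀)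
  have hle := le_of_tendsto (hT.sub_const Z).norm (Filter.Eventually.of_forall fun N => by
    simpa only [Function.comp_apply, add_comm N N₀] using hZ N)
  rw [sum_Ioc_floor_eq_integral_add (g := fun x => eChar (f x)) (fun x => (hf x).eChar)
    (by fun_prop) hab]
  have h0 : phaseIntegral f a b 0 = ∫ t in a..b, eChar (f t) := by simp [phaseIntegral]
  rw [h0]
  have h1 := norm_fract_sub_half_mul_eChar_le b (f b)
  have h2 := norm_fract_sub_half_mul_eChar_le a (f a)
  set I := ∫ t in a..b, ((Int.fract t - 1 / 2 : ℝ) : ℂ) * (2 * π * Complex.I * f₁ t * eChar (f t))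
  set J := ∫ t in a..b, eChar (f t)
  set B := ((Int.fract b - 1 / 2 : ℝ) : ℂ) * eChar (f b)
  set A := ((Int.fract a - 1 / 2 : ℝ) : ℂ) * eChar (f a)
  have heq : J + I - B + A - (J + Z) = (I - Z) - B + A := by ring
  rw [heq]
  calc _ ≤ ‖I - Z‖ + ‖B‖ + ‖A‖ := (norm_add_le _ _).trans (by gcongr; exact norm_sub_le _ _)
    _ ≤ 1 + C := by linarith

/-- The endpoint terms of the first derivative test are merged with those of `poissonTerm` before
taking norms. Without this cancellation the bounds would not be summable over `ν`. -/
lemma norm_poissonTerm_le (hf : ∀ x, HasDerivAt f (f₁ x) x)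
    (hf₁ : ∀ x, HasDerivAt f₁ (-q x) x) (hq : ∀ x, 0 ≤ q x) (hab : a ≤ b) {ν : ℤ}
    (hne : ∀ x ∈ Icc a b, f₁ x - ν ≠ 0) :
    ‖poissonTerm f a b ν‖ ≤ 1 / (2 * π) * (|1 / (f₁ b - ν) + 1 / ν| + |1 / (f₁ a - ν) + 1 / ν| +
      (1 / (f₁ b - ν) - 1 / (f₁ a - ν))) := by
  have h := norm_integral_eChar_sub_boundary_le (f := fun x => f x - ν * x)
    (f₁ := fun x => f₁ x - ν) (fun x => (hf x).sub_int_mul ν) (fun x => (hf₁ x).sub_const _) hq hab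
    hne
  have hn : ∀ y r : ℝ, ‖eChar y / (2 * π * Complex.I) * (r : ℂ)‖ = 1 / (2 * π) * |r| := by
    intro y r
    simp only [norm_div, norm_mul, norm_eChar, Complex.norm_real, Complex.norm_I, Complex.norm_two,
      norm_eq_abs, abs_of_pos pi_pos, mul_one]
  have hb := hn (f b - ν * b) (1 / (f₁ b - ν) + 1 / ν)
  have ha := hn (f a - ν * a) (1 / (f₁ a - ν) + 1 / ν)
  set D := (∫ x in a..b, eChar (f x - ν * x)) -
    (eChar (f b - ν * b) / (2 * π * Complex.I * (f₁ b - ν : ℝ)) -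
      eChar (f a - ν * a) / (2 * π * Complex.I * (f₁ a - ν : ℝ))) with hD
  have heq : poissonTerm f a b ν = eChar (f b - ν * b) / (2 * π * Complex.I) *
      ((1 / (f₁ b - ν) + 1 / ν : ℝ) : ℂ) - eChar (f a - ν * a) / (2 * π * Complex.I) *
      ((1 / (f₁ a - ν) + 1 / ν : ℝ) : ℂ) + D := by
    rw [hD, poissonTerm, phaseIntegral]
    push_cast
    generalize (f₁ b - ν : ℂ) = u, (f₁ a - ν : ℂ) = v
    ring
  rw [heq]
  refine (norm_add_le _ _).trans ((add_le_add_left (norm_sub_le _ _) _).trans ?_)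
  rw [ha, hb]
  linarith

lemma norm_poissonTerm_neg_le (hf : ∀ x, HasDerivAt f (f₁ x) x)
    (hf₁ : ∀ x, HasDerivAt f₁ (-q x) x) (hq : ∀ x, 0 ≤ q x) (hab : a ≤ b) (hb : 0 ≤ f₁ b) {m : ℕ}
    (hm : 0 < m) :
    ‖poissonTerm f a b (-m)‖ ≤ 1 / π * (1 / m - 1 / (m + f₁ a)) := by
  have hanti := antitone_of_deriv_neg hf₁ hq
  have hm0 : (0 : ℝ) < m := by exact_mod_cast hm
  have hba := hanti hab
  refine (norm_poissonTerm_le hf hf₁ hq hab fun x hx => ?_).trans ?_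
  · have := hanti hx.2
    push_cast
    linarith
  · push_cast
    rw [div_neg, sub_neg_eq_add, sub_neg_eq_add, add_comm (f₁ b), add_comm (f₁ a)]
    have h1 : 1 / (m + f₁ b) ≤ 1 / (m : ℝ) := one_div_le_one_div_of_le hm0 (by linarith)
    have h2 : 1 / (m + f₁ a) ≤ 1 / (m : ℝ) := one_div_le_one_div_of_le hm0 (by linarith)
    rw [abs_of_nonpos (by linarith), abs_of_nonpos (by linarith)]
    apply le_of_eq
    ring

lemma norm_poissonTerm_le_of_lt (hf : ∀ x, HasDerivAt f (f₁ x) x)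
    (hf₁ : ∀ x, HasDerivAt f₁ (-q x) x) (hq : ∀ x, 0 ≤ q x) (hab : a ≤ b) (hb : 0 ≤ f₁ b) {m : ℕ}
    (hm : f₁ a < m) :
    ‖poissonTerm f a b m‖ ≤ 1 / π * (1 / (m - f₁ a) - 1 / m) := by
  have hanti := antitone_of_deriv_neg hf₁ hq
  have hba := hanti hab
  refine (norm_poissonTerm_le hf hf₁ hq hab fun x hx => ?_).trans ?_
  · have := hanti hx.1
    push_cast
    linarith
  · push_cast
    rw [← neg_sub (m : ℝ) (f₁ b), ← neg_sub (m : ℝ) (f₁ a), div_neg, div_neg]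
    have h1 : 1 / (m : ℝ) ≤ 1 / (m - f₁ b) := one_div_le_one_div_of_le (by linarith) (by linarith)
    have h2 : 1 / (m : ℝ) ≤ 1 / (m - f₁ a) := one_div_le_one_div_of_le (by linarith) (by linarith)
    rw [abs_of_nonpos (by linarith), abs_of_nonpos (by linarith)]
    apply le_of_eq
    ring

lemma norm_poissonTerm_sub_phaseIntegral_le (f : ℝ → ℝ) (a b : ℝ) (m : ℕ) :
    ‖poissonTerm f a b m - phaseIntegral f a b m‖ ≤ 1 / π * (1 / m) := by
  rw [poissonTerm, add_sub_cancel_left, norm_div]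
  have h1 : ‖eChar (f b - (m : ℤ) * b) - eChar (f a - (m : ℤ) * a)‖ ≤ 2 :=
    (norm_sub_le _ _).trans (by rw [norm_eChar, norm_eChar]; norm_num)
  have h2 : ‖(2 * π * Complex.I * ((m : ℤ) : ℂ) : ℂ)‖ = 2 * (π * m) := by
    simp [abs_of_pos pi_pos, mul_assoc]
  rw [h2]
  calc _ ≤ 2 / (2 * (π * m)) := by gcongr
    _ = 1 / π * (1 / m) := by rw [div_mul_div_comm, one_mul, ← div_div, div_self two_ne_zero]

lemma sum_range_one_div_le (n : ℕ) :
    ∑ i ∈ Finset.range n, 1 / ((i : ℝ) + 1) ≤ 1 + Real.log n := by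
  have h := harmonic_le_one_add_log n
  rw [harmonic] at h
  push_cast at h
  simpa only [one_div] using h

/-- Once `y` is rounded up to `K` the sum telescopes, to `H_L - (H_{K+L} - H_K) ≤ H_K` for harmonic
numbers `H`. -/
lemma sum_range_sub_le {y : ℝ} (L K : ℕ) (hy : 0 ≤ y) (hK : y ≤ K) :
    ∑ j ∈ Finset.range L, (1 / ((j : ℝ) + 1) - 1 / ((j : ℝ) + 1 + y)) ≤
      ∑ i ∈ Finset.range K, 1 / ((i : ℝ) + 1) := by
  have h1 : ∑ j ∈ Finset.range L, (1 / ((j : ℝ) + 1) - 1 / ((j : ℝ) + 1 + y)) ≤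
      ∑ j ∈ Finset.range L, (1 / ((j : ℝ) + 1) - 1 / (((K + j : ℕ) : ℝ) + 1)) := by
    refine Finset.sum_le_sum fun j _ => sub_le_sub_left (one_div_le_one_div_of_le (by positivity) ?_) _
    push_cast
    linarith
  refine h1.trans ?_
  have h2 := Finset.sum_range_add (fun i : ℕ => 1 / ((i : ℝ) + 1)) K L
  have h3 : ∑ i ∈ Finset.range L, 1 / ((i : ℝ) + 1) ≤
      ∑ i ∈ Finset.range (K + L), 1 / ((i : ℝ) + 1) :=
    Finset.sum_le_sum_of_subset_of_nonneg (Finset.range_mono (by omega))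
      fun i _ _ => by positivity
  rw [Finset.sum_sub_distrib]
  linarith

/-- The exponential sum as a sum of oscillatory integrals (van der Corput). -/
lemma norm_sum_eChar_sub_phaseIntegral_le (hf : ∀ x, HasDerivAt f (f₁ x) x)
    (hf₁ : ∀ x, HasDerivAt f₁ (-q x) x) (hq : ∀ x, 0 ≤ q x) (hqc : Continuous q) (hab : a ≤ b)
    (hb : 0 ≤ f₁ b) {K : ℕ} (hK : f₁ a < K + 1) :
    ‖(∑ n ∈ Finset.Ioc ⌊a⌋ ⌊b⌋, eChar (f n)) - (phaseIntegral f a b 0 +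
        ∑ i ∈ Finset.range K, phaseIntegral f a b (i + 1 : ℕ))‖ ≤
      1 + 1 / π + ‖phaseIntegral f a b (K + 1 : ℕ)‖ + 3 / π * (1 + Real.log (K + 1)) := by
  have hba : 0 ≤ f₁ a := hb.trans (antitone_of_deriv_neg hf₁ hq hab)
  set S := ∑ i ∈ Finset.range (K + 1), 1 / ((i : ℝ) + 1) with hS
  have hSle : S ≤ 1 + Real.log (K + 1) := by
    have := sum_range_one_div_le (K + 1)
    push_cast at this
    exact this
  have hpi := pi_pos
  refine (norm_sum_eChar_sub_le_of_poissonTerm hf hf₁ hqc hab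
    (∑ i ∈ Finset.range K, phaseIntegral f a b (i + 1 : ℕ))
    (1 / π + ‖phaseIntegral f a b (K + 1 : ℕ)‖ + 3 / π * S) (K + 1) fun N => ?_).trans ?_
  -- The negative frequencies, the endpoint parts for `1, …, K`, and the frequencies from `K + 2` on
  -- cost `S/π` each. Frequency `K + 1` is kept apart, as `f₁ a` may be arbitrarily close to it.
  · rw [Finset.sum_add_distrib, Finset.sum_range_add _ (K + 1) N, Finset.sum_range_succ _ K]
    have e1 : ‖∑ n ∈ Finset.range (K + 1 + N), poissonTerm f a b (-(n + 1 : ℕ))‖ ≤ 1 / π * S := by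
      refine (norm_sum_le _ _).trans ((Finset.sum_le_sum fun n _ =>
        norm_poissonTerm_neg_le hf hf₁ hq hab hb n.succ_pos).trans ?_)
      rw [← Finset.mul_sum]
      push_cast
      gcongr
      exact sum_range_sub_le _ (K + 1) hba (by push_cast; exact hK.le)
    have e2 : ‖(∑ i ∈ Finset.range K, poissonTerm f a b (i + 1 : ℕ)) -
        ∑ i ∈ Finset.range K, phaseIntegral f a b (i + 1 : ℕ)‖ ≤ 1 / π * S := by
      rw [← Finset.sum_sub_distrib]
      refine (norm_sum_le _ _).trans ((Finset.sum_le_sum fun n _ =>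
        norm_poissonTerm_sub_phaseIntegral_le f a b (n + 1)).trans ?_)
      rw [← Finset.mul_sum]
      push_cast
      gcongr
      exact Finset.sum_le_sum_of_subset_of_nonneg (Finset.range_mono (by omega))
        fun i _ _ => by positivity
    have e3 : ‖poissonTerm f a b (K + 1 : ℕ)‖ ≤ 1 / π + ‖phaseIntegral f a b (K + 1 : ℕ)‖ := by
      have h1 := norm_le_norm_add_norm_sub' (poissonTerm f a b (K + 1 : ℕ))
        (phaseIntegral f a b (K + 1 : ℕ))
      have h2 := norm_poissonTerm_sub_phaseIntegral_le f a b (K + 1)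
      have h3 : 1 / π * (1 / ((K + 1 : ℕ) : ℝ)) ≤ 1 / π := by
        refine mul_le_of_le_one_right (by positivity) ?_
        rw [div_le_one (by positivity)]
        push_cast
        linarith [(Nat.cast_nonneg K : (0 : ℝ) ≤ K)]
      linarith
    have e4 : ‖∑ j ∈ Finset.range N, poissonTerm f a b (K + 1 + j + 1 : ℕ)‖ ≤ 1 / π * S := by
      have hlt : ∀ j : ℕ, f₁ a < ((K + 1 + j + 1 : ℕ) : ℝ) := fun j => by
        push_cast
        linarith [(Nat.cast_nonneg j : (0 : ℝ) ≤ j)]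
      refine (norm_sum_le _ _).trans ((Finset.sum_le_sum fun j _ =>
        norm_poissonTerm_le_of_lt hf hf₁ hq hab hb (hlt j)).trans ?_)
      rw [← Finset.mul_sum]
      gcongr
      refine le_trans (Finset.sum_le_sum fun j _ => ?_)
        (sum_range_sub_le N (K + 1) hba (by push_cast; exact hK.le))
      have hj : (0 : ℝ) ≤ j := Nat.cast_nonneg j
      have hcast : ((K + 1 + j + 1 : ℕ) : ℝ) = K + 1 + j + 1 := by push_cast; ring
      rw [hcast, div_sub_div _ _ (by linarith) (by linarith),
        div_sub_div _ _ (by linarith) (by linarith)]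
      have hnum : 1 * ((K : ℝ) + 1 + j + 1) - (K + 1 + j + 1 - f₁ a) * 1 = f₁ a := by ring
      have hnum' : 1 * ((j : ℝ) + 1 + f₁ a) - (j + 1) * 1 = f₁ a := by ring
      rw [hnum, hnum']
      refine div_le_div_of_nonneg_left hba (by positivity) ?_
      refine mul_le_mul (by linarith) (by linarith) (by linarith) (by linarith)
    set A := ∑ i ∈ Finset.range K, poissonTerm f a b (i + 1 : ℕ)
    set B := ∑ i ∈ Finset.range K, phaseIntegral f a b (i + 1 : ℕ)
    set C := poissonTerm f a b (K + 1 : ℕ)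
    set D := ∑ j ∈ Finset.range N, poissonTerm f a b (K + 1 + j + 1 : ℕ)
    set G := ∑ n ∈ Finset.range (K + 1 + N), poissonTerm f a b (-(n + 1 : ℕ))
    have heq : A + C + D + G - B = (A - B) + C + D + G := by ring
    rw [heq]
    refine norm_add₄_le.trans ?_
    have : 3 / π * S = 1 / π * S + 1 / π * S + 1 / π * S := by ring
    linarith
  · have : 3 / π * S ≤ 3 / π * (1 + Real.log (K + 1)) := by gcongr
    linarith

end Poisson

/-! ### Stationary phase on an interval -/

/-- The bound for a one-sided oscillatory integral whose phase has second derivative at least `lam`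
in absolute value, and first derivative at least `x` in absolute value. -/
noncomputable def tailBound (lam x : ℝ) : ℝ :=
  if 0 < x then min (2 / √(π * lam)) (1 / (π * x)) else 2 / √(π * lam)

lemma tailBound_le (lam x : ℝ) : tailBound lam x ≤ 2 / √(π * lam) := by
  unfold tailBound
  split_ifs
  · exact min_le_left _ _
  · exact le_rfl

lemma tailBound_le_of_pos (lam : ℝ) {x : ℝ} (hx : 0 < x) : tailBound lam x ≤ 1 / (π * x) := by
  rw [tailBound, if_pos hx]
  exact min_le_right _ _

lemma le_tailBound {lam x y : ℝ} (h : y ≤ 2 / √(π * lam)) (h' : 0 < x → y ≤ 1 / (π * x)) :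
    y ≤ tailBound lam x := by
  unfold tailBound
  split_ifs with hx
  · exact le_min h (h' hx)
  · exact h

/-- One of `x`, `1 - x` is at least `1/2`. Thus of two consecutive frequencies around an endpoint
value of `f'`, only one needs the second derivative test. -/
lemma tailBound_add_one_sub_le (lam x : ℝ) :
    tailBound lam x + tailBound lam (1 - x) ≤ 2 / √(π * lam) + 2 / π := by
  have key : ∀ y : ℝ, 1 / 2 ≤ y → tailBound lam y ≤ 2 / π := by
    intro y hy
    refine (tailBound_le_of_pos lam (by linarith)).trans ?_
    rw [div_le_div_iff₀ (by positivity) pi_pos]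
    nlinarith [pi_pos]
  rcases le_total (1 / 2) x with h | h
  · linarith [key x h, tailBound_le lam (1 - x)]
  · linarith [key (1 - x) (by linarith), tailBound_le lam x]

section StationaryPhase

variable {f f₁ q : ℝ → ℝ} {a b c lam M X : ℝ}

lemma norm_integral_eChar_le_tailBound_of_nonneg (hf : ∀ x, HasDerivAt f (f₁ x) x)
    (hf₁ : ∀ x, HasDerivAt f₁ (-q x) x) (hlam : 0 < lam) (hq : ∀ x, lam ≤ q x) (hab : a ≤ b)
    (hb : 0 ≤ f₁ b) : ‖∫ x in a..b, eChar (f x)‖ ≤ tailBound lam (f₁ b) :=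
  le_tailBound (norm_integral_eChar_le_of_nonneg hf hf₁ hlam hq hab hb)
    fun h => norm_integral_eChar_le_of_pos hf hf₁ (fun x => hlam.le.trans (hq x)) hab h

lemma norm_integral_eChar_le_tailBound_of_nonpos (hf : ∀ x, HasDerivAt f (f₁ x) x)
    (hf₁ : ∀ x, HasDerivAt f₁ (-q x) x) (hlam : 0 < lam) (hq : ∀ x, lam ≤ q x) (hab : a ≤ b)
    (ha : f₁ a ≤ 0) : ‖∫ x in a..b, eChar (f x)‖ ≤ tailBound lam (-f₁ a) :=
  le_tailBound (norm_integral_eChar_le_of_nonpos hf hf₁ hlam hq hab ha)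
    fun h => norm_integral_eChar_le_of_neg hf hf₁ (fun x => hlam.le.trans (hq x)) hab
      (by linarith)

/-- Stationary phase with an explicit error term, depending on a cutoff `X`. -/
lemma norm_integral_eChar_sub_stationary_le (hf : ∀ x, HasDerivAt f (f₁ x) x)
    (hf₁ : ∀ x, HasDerivAt f₁ (-q x) x) (hlam : 0 < lam) (hq : ∀ x, lam ≤ q x) (hM0 : 0 ≤ M)
    (hM : ∀ x y, |q x - q y| ≤ M * |x - y|) (hac : a ≤ c) (hcb : c ≤ b) (hc : f₁ c = 0)
    (hX : 0 < X) :
    ‖(∫ x in a..b, eChar (f x)) - eChar (f c - 1 / 8) / (√(q c) : ℝ)‖ ≤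
      2 * (M * X ^ 2 / (3 * lam) + 1 / (π * lam * X)) +
        (tailBound lam (f₁ a) + tailBound lam (-f₁ b)) := by
  have hcont : Continuous fun x => eChar (f x) :=
    continuous_iff_continuousAt.2 fun x => (hf x).eChar.continuousAt
  have hanti := antitone_of_deriv_neg hf₁ fun x => hlam.le.trans (hq x)
  have hint : ∀ u v, IntervalIntegrable (fun x => eChar (f x)) MeasureTheory.volume u v :=
    fun u v => hcont.intervalIntegrable u v
  -- This `L` makes `[c - L, c + L]` contain `[a, b]` and both cutoffs. The one-sided results apply
  -- on each half, and the two excess pieces, where `f₁` has constant sign, are bounded by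
  -- `tailBound`.
  set L := X + (b - a) with hL
  have hXL : X ≤ L := by linarith
  have hR := norm_integral_eChar_sub_half_le (f := fun x => f (c + x) - f c)
    (f₁ := fun x => f₁ (c + x)) (q := fun x => q (c + x)) (lam := lam) (M := M)
    (fun x => ((hf (c + x)).comp_const_add c x).sub_const _)
    (fun x => (hf₁ (c + x)).comp_const_add c x) (by simp) (by simpa using hc) hlam
    (fun x => hq _) hM0 (fun x => by simpa using hM (c + x) (c + 0)) hX hXL
  have hLft := norm_integral_eChar_sub_half_le (f := fun x => f (c - x) - f c)
    (f₁ := fun x => -f₁ (c - x)) (q := fun x => q (c - x)) (lam := lam) (M := M)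
    (fun x => ((hf (c - x)).comp_const_sub c x).sub_const _)
    (fun x => ((hf₁ (c - x)).comp_const_sub c x).neg.congr_deriv (by ring)) (by simp)
    (by simpa using hc) hlam (fun x => hq _) hM0
    (fun x => by simpa using hM (c - x) (c - 0)) hX hXL
  have hshift : ∀ y, eChar (y - f c) = eChar y * eChar (-f c) := fun y => by
    rw [sub_eq_add_neg, eChar_add]
  simp only [hshift, intervalIntegral.integral_mul_const, add_zero, sub_zero] at hR hLft
  rw [intervalIntegral.integral_comp_add_left (fun x => eChar (f x)) c, add_zero] at hR
  rw [intervalIntegral.integral_comp_sub_left (fun x => eChar (f x)) c, sub_zero] at hLft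
  have htb := norm_integral_eChar_le_tailBound_of_nonpos hf hf₁ hlam hq
    (show b ≤ c + L by linarith) (by rw [← hc]; exact hanti hcb)
  have hta := norm_integral_eChar_le_tailBound_of_nonneg hf hf₁ hlam hq
    (show c - L ≤ a by linarith) (by rw [← hc]; exact hanti hac)
  have hs1 := intervalIntegral.integral_add_adjacent_intervals (hint (c - L) a) (hint a b)
  have hs2 := intervalIntegral.integral_add_adjacent_intervals (hint (c - L) b) (hint b (c + L))
  have hs3 := intervalIntegral.integral_add_adjacent_intervals (hint (c - L) c) (hint c (c + L))
  have hone : eChar (f c) * eChar (-f c) = 1 := by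
    rw [← eChar_add, add_neg_cancel, eChar_zero]
  set J := ∫ x in a..b, eChar (f x)
  set A := ∫ x in (c - L)..a, eChar (f x)
  set B := ∫ x in b..(c + L), eChar (f x)
  set P := ∫ x in (c - L)..c, eChar (f x)
  set R := ∫ x in c..(c + L), eChar (f x)
  have hmain : eChar (f c - 1 / 8) = eChar (f c) * eChar (-(1 / 8)) := by
    rw [sub_eq_add_neg, eChar_add]
  have heq : J - eChar (f c - 1 / 8) / (√(q c) : ℝ) =
      eChar (f c) * (R * eChar (-f c) - eChar (-(1 / 8)) / (2 * (√(q c) : ℝ))) +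
      eChar (f c) * (P * eChar (-f c) - eChar (-(1 / 8)) / (2 * (√(q c) : ℝ))) +
      (-A - B) := by
    have hJ : J = R + P - A - B := by
      linear_combination hs1 + hs2 - hs3
    rw [hJ, hmain]
    linear_combination (-(R + P)) * hone
  rw [heq]
  refine (norm_add₃_le).trans ?_
  rw [norm_mul, norm_mul, norm_eChar, one_mul, one_mul]
  have hAB : ‖-A - B‖ ≤ ‖A‖ + ‖B‖ := (norm_sub_le _ _).trans (by rw [norm_neg])
  linarith

/-- Stationary phase, the error being of the order of the cube root of the third derivative. -/
lemma norm_integral_eChar_sub_stationary_le_cube_root {r : ℝ} (hf : ∀ x, HasDerivAt f (f₁ x) x)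
    (hf₁ : ∀ x, HasDerivAt f₁ (-q x) x) (hlam : 0 < lam) (hq : ∀ x, lam ≤ q x) (hr : 0 ≤ r)
    (hM : ∀ x y, |q x - q y| ≤ r ^ 3 * |x - y|) (hac : a ≤ c) (hcb : c ≤ b) (hc : f₁ c = 0) :
    ‖(∫ x in a..b, eChar (f x)) - eChar (f c - 1 / 8) / (√(q c) : ℝ)‖ ≤
      1.223 * (r / lam) + (tailBound lam (f₁ a) + tailBound lam (-f₁ b)) := by
  have key := fun X => norm_integral_eChar_sub_stationary_le (X := X) hf hf₁ hlam hq (by positivity) hM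
    hac hcb hc
  rcases hr.eq_or_lt with rfl | hr0
  -- For `r = 0` the phase is quadratic and the cutoff may tend to infinity.
  · have hlim : Filter.Tendsto (fun X : ℝ => 2 * ((0 : ℝ) ^ 3 * X ^ 2 / (3 * lam) +
        1 / (π * lam * X)) + (tailBound lam (f₁ a) + tailBound lam (-f₁ b))) Filter.atTop
        (nhds (2 * (0 + 0) + (tailBound lam (f₁ a) + tailBound lam (-f₁ b)))) := by
      refine ((Filter.Tendsto.add ?_ ?_).const_mul 2).add_const _
      · simp
      · refine Filter.Tendsto.const_div_atTop ?_ 1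
        exact Filter.tendsto_id.const_mul_atTop (by positivity)
    have h := ge_of_tendsto hlim (Filter.eventually_gt_atTop 0 |>.mono key)
    simpa using h
  -- With `X = x/r` the error is `(2x²/3 + 2/(πx)) r/λ`, minimal at `x = (3/(2π))^(1/3)`, about
  -- `0.78`.
  · refine (key (0.78 / r) (by positivity)).trans (add_le_add_left ?_ _)
    have h1 : 2 * (r ^ 3 * (0.78 / r) ^ 2 / (3 * lam) + 1 / (π * lam * (0.78 / r))) =
        (2 * 0.78 ^ 2 / 3 + 2 / (0.78 * π)) * (r / lam) := by
      field_simp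
    rw [h1]
    gcongr
    have h2 : 2 / (0.78 * π) ≤ 2 / (0.78 * 3.14) := by
      have := pi_gt_d2
      gcongr
    refine (add_le_add_right h2 _).trans ?_
    norm_num

/-- Trivial stationary phase, from the second derivative test. -/
lemma norm_integral_eChar_sub_stationary_le_second (hf : ∀ x, HasDerivAt f (f₁ x) x)
    (hf₁ : ∀ x, HasDerivAt f₁ (-q x) x) (hlam : 0 < lam) (hq : ∀ x, lam ≤ q x)
    (hac : a ≤ c) (hcb : c ≤ b) (hc : f₁ c = 0) :
    ‖(∫ x in a..b, eChar (f x)) - eChar (f c - 1 / 8) / (√(q c) : ℝ)‖ ≤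
      2 * (2 / √(π * lam)) + 1 / √lam := by
  have hcont : Continuous fun x => eChar (f x) :=
    continuous_iff_continuousAt.2 fun x => (hf x).eChar.continuousAt
  rw [← intervalIntegral.integral_add_adjacent_intervals (hcont.intervalIntegrable a c)
    (hcont.intervalIntegrable c b)]
  have h1 := norm_integral_eChar_le_of_nonneg hf hf₁ hlam hq hac hc.ge
  have h2 := norm_integral_eChar_le_of_nonpos hf hf₁ hlam hq hcb hc.le
  have h3 : ‖eChar (f c - 1 / 8) / (√(q c) : ℝ)‖ ≤ 1 / √lam := by
    rw [norm_div, norm_eChar, Complex.norm_real, norm_eq_abs, abs_of_nonneg (sqrt_nonneg _)]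
    have := sqrt_le_sqrt (hq c)
    have := sqrt_pos.2 hlam
    gcongr
  refine (norm_sub_le _ _).trans ?_
  linarith [norm_add_le (∫ x in a..c, eChar (f x)) (∫ x in c..b, eChar (f x))]

end StationaryPhase

/-! ### Summing the errors over the frequencies -/

section Sums

lemma two_div_sqrt_pi_mul_le {lam : ℝ} (hlam : 0 < lam) : 2 / √(π * lam) ≤ 1.129 * (1 / √lam) := by
  have hs := sqrt_pos.2 hlam
  have h : (1.772 : ℝ) ≤ √π := le_sqrt_of_sq_le (by have := pi_gt_d4; norm_num at this ⊢; linarith)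
  rw [sqrt_mul pi_pos.le, ← div_div, div_eq_mul_one_div (2 / √π)]
  gcongr
  rw [div_le_iff₀ (by linarith)]
  linarith

lemma sum_tailBound_le (lam : ℝ) (K : ℕ) {y : ℝ} (hy : y ≤ 1) :
    ∑ i ∈ Finset.range (K + 1), tailBound lam (i + 1 - y) ≤
      tailBound lam (1 - y) + 1 / π * (1 + Real.log K) := by
  rw [Finset.sum_range_succ', add_comm]
  push_cast
  rw [zero_add]
  gcongr
  refine le_trans ?_ (mul_le_mul_of_nonneg_left (sum_range_one_div_le K) (by positivity))
  rw [Finset.mul_sum]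
  refine Finset.sum_le_sum fun i _ => ?_
  have hi : (0 : ℝ) ≤ i := Nat.cast_nonneg i
  have hpi := pi_pos
  refine (tailBound_le_of_pos lam (by linarith)).trans ?_
  rw [div_mul_div_comm, one_mul]
  gcongr
  linarith

end Sums

/-- Since `1.58 · 1.223 < 2 · 0.969`, the part `1.58 ED` of `(D + 1)E` is absorbed by the cube root
term. As `D ≥ 1`, the rest is at most `0.42 E`, which the second derivative bound makes
`O(λ^(-1/2))`. -/
lemma stationary_error_sum_le {lam r D h k E : ℝ} {K : ℕ} (hlam : 0 < lam)
    (hE1 : E ≤ 1.223 * (r / lam)) (hE2 : E ≤ 2 * (2 / √(π * lam)) + 1 / √lam) (hE0 : 0 ≤ E)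
    (hD : 1 ≤ D) (hK : (K : ℝ) ≤ D + 1) (hk : 0.969 ≤ k) (hDh : D ≤ h) (hr : 0 ≤ r) :
    K * E + 2 * (2 / √(π * lam)) ≤ 4.686 * (1 / √lam) + 2 * k * (r / lam) * h := by
  have hs := two_div_sqrt_pi_mul_le hlam
  have hrl : 0 ≤ r / lam := by positivity
  have h1 : K * E ≤ (D + 1) * E := by gcongr
  have h2 : 1.58 * E ≤ 2 * 0.969 * (r / lam) := by linarith
  have h3 : 1.58 * E * D ≤ 2 * 0.969 * (r / lam) * D :=
    mul_le_mul_of_nonneg_right h2 (by linarith)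
  have h4 : 2 * 0.969 * (r / lam) * D ≤ 2 * k * (r / lam) * h := by gcongr
  have h5 : E ≤ E * D := le_mul_of_one_le_right hE0 hD
  have h6 : 0 ≤ 1 / √lam := by positivity
  linarith

/-! ### The B-process on the real line -/

section Global

variable {f f₁ q : ℝ → ℝ} {a b lam r : ℝ}

lemma phaseIntegral_bounds (hf : ∀ x, HasDerivAt f (f₁ x) x)
    (hf₁ : ∀ x, HasDerivAt f₁ (-q x) x) (hlam : 0 < lam) (hq : ∀ x, lam ≤ q x) (hr : 0 ≤ r)
    (hM : ∀ x y, |q x - q y| ≤ r ^ 3 * |x - y|) {c : ℝ} {ν : ℤ} (hc : c ∈ Icc a b)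
    (hcν : f₁ c = ν) :
    ‖phaseIntegral f a b ν - eChar (f c - ν * c - 1 / 8) / (√(q c) : ℝ)‖ ≤
        1.223 * (r / lam) + (tailBound lam (f₁ a - ν) + tailBound lam (ν - f₁ b)) ∧
      ‖phaseIntegral f a b ν - eChar (f c - ν * c - 1 / 8) / (√(q c) : ℝ)‖ ≤
        2 * (2 / √(π * lam)) + 1 / √lam := by
  have h1 : ∀ x, HasDerivAt (fun x => f x - ν * x) (f₁ x - ν) x := fun x => (hf x).sub_int_mul ν
  have h2 : ∀ x, HasDerivAt (fun x => f₁ x - ν) (-q x) x := fun x => (hf₁ x).sub_const _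
  have h3 : f₁ c - ν = 0 := sub_eq_zero.2 hcν
  have e1 := norm_integral_eChar_sub_stationary_le_cube_root h1 h2 hlam hq hr hM hc.1 hc.2 h3
  have e2 := norm_integral_eChar_sub_stationary_le_second h1 h2 hlam hq hc.1 hc.2 h3
  rw [neg_sub] at e1
  exact ⟨e1, e2⟩

/-- The van der Corput `B`-process for a concave phase on the real line whose derivative at the
right endpoint lies in `[0, 1)`. -/
lemma norm_sum_eChar_sub_sum_stationary_le (hf : ∀ x, HasDerivAt f (f₁ x) x)
    (hf₁ : ∀ x, HasDerivAt f₁ (-q x) x) (hlam : 0 < lam) (hq : ∀ x, lam ≤ q x)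
    (hqc : Continuous q) (hr : 0 ≤ r)
    (hM : ∀ x y, |q x - q y| ≤ r ^ 3 * |x - y|) (hab : a ≤ b) (hb0 : 0 ≤ f₁ b) (hb1 : f₁ b < 1)
    {h k : ℝ} (hk : 0.969 ≤ k) (hh : f₁ a - f₁ b ≤ h) {K : ℕ} (hK : (K : ℝ) ≤ f₁ a)
    (hK' : f₁ a < K + 1) (c : ℕ → ℝ) (hc : ∀ i < K, c i ∈ Icc a b ∧ f₁ (c i) = i + 1) :
    ‖(∑ n ∈ Finset.Ioc ⌊a⌋ ⌊b⌋, eChar (f n)) - ∑ i ∈ Finset.range K,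
        eChar (f (c i) - (i + 1) * c i - 1 / 8) / (√(q (c i)) : ℝ)‖ ≤
      4.686 * (1 / √lam) + 2 * k * (r / lam) * h + 5 / π * Real.log (f₁ a - f₁ b + 2) + 6 := by
  have hpi := pi_gt_three
  have hq0 : ∀ x, 0 ≤ q x := fun x => hlam.le.trans (hq x)
  have hba : f₁ b ≤ f₁ a := antitone_of_deriv_neg hf₁ hq0 hab
  have hs := two_div_sqrt_pi_mul_le hlam
  have hs0 : 0 ≤ 1 / √lam := by positivity
  have hrl : 0 ≤ r / lam := by positivity
  have hW : 0 ≤ 2 * k * (r / lam) * h :=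
    mul_nonneg (mul_nonneg (by linarith) hrl) (by linarith)
  have h1π : 1 / π ≤ 1 / 3 := one_div_le_one_div_of_le (by norm_num) hpi.le
  have h1π0 : 0 ≤ 1 / π := by positivity
  set ℓ := Real.log (f₁ a - f₁ b + 2) with hℓ
  have hℓ0 : 0 ≤ ℓ := Real.log_nonneg (by linarith)
  have hlogK : Real.log (K + 1) ≤ ℓ := Real.log_le_log (by positivity) (by linarith)
  have hP := norm_sum_eChar_sub_phaseIntegral_le hf hf₁ hq0 hqc hab hb0 hK'
  have hlow : ‖phaseIntegral f a b 0‖ ≤ tailBound lam (f₁ b) := by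
    simpa [phaseIntegral] using norm_integral_eChar_le_tailBound_of_nonneg hf hf₁ hlam hq hab hb0
  have hupp : ‖phaseIntegral f a b (K + 1 : ℕ)‖ ≤ tailBound lam (1 - (f₁ a - K)) := by
    have h := norm_integral_eChar_le_tailBound_of_nonpos
      (fun x => (hf x).sub_int_mul ((K + 1 : ℕ) : ℤ)) (fun x => (hf₁ x).sub_const _) hlam hq hab
      (by push_cast; linarith)
    rw [phaseIntegral]
    convert h using 2
    push_cast
    ring
  have hbd : ∀ i < K, _ := fun i hi => phaseIntegral_bounds (ν := ((i + 1 : ℕ) : ℤ)) hf hf₁ hlam hq hr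
    hM (hc i hi).1 (by rw [(hc i hi).2]; push_cast; ring)
  push_cast at hbd
  set S := ∑ n ∈ Finset.Ioc ⌊a⌋ ⌊b⌋, eChar (f n) with hS
  set main : ℕ → ℂ := fun i => eChar (f (c i) - (i + 1) * c i - 1 / 8) / (√(q (c i)) : ℝ) with hmain
  have htri : ‖S - ∑ i ∈ Finset.range K, main i‖ ≤
      (1 + 1 / π + ‖phaseIntegral f a b (K + 1 : ℕ)‖ + 3 / π * (1 + Real.log (K + 1))) +
      (‖phaseIntegral f a b 0‖ +
        ∑ i ∈ Finset.range K, ‖phaseIntegral f a b (i + 1 : ℕ) - main i‖) := by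
    have heq : S - ∑ i ∈ Finset.range K, main i = (S - (phaseIntegral f a b 0 +
        ∑ i ∈ Finset.range K, phaseIntegral f a b (i + 1 : ℕ))) + (phaseIntegral f a b 0 +
        ∑ i ∈ Finset.range K, (phaseIntegral f a b (i + 1 : ℕ) - main i)) := by
      rw [Finset.sum_sub_distrib]
      ring
    rw [heq]
    refine (norm_add_le _ _).trans (add_le_add hP ((norm_add_le _ _).trans ?_))
    gcongr
    exact norm_sum_le _ _
  refine htri.trans ?_
  have hlog3 : 3 / π * (1 + Real.log (K + 1)) ≤ 3 * (1 / π) + 3 * (1 / π * ℓ) := by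
    have : 3 / π * (1 + Real.log (K + 1)) ≤ 3 / π * (1 + ℓ) := by gcongr
    refine this.trans (le_of_eq ?_)
    ring
  have hlog5 : 5 / π * ℓ = 5 * (1 / π * ℓ) := by ring
  have hπℓ : 0 ≤ 1 / π * ℓ := by positivity
  rw [hlog5]
  -- For a range of `f'` shorter than 1 the cube root term cannot absorb the error, but then at most
  -- one frequency is stationary and the second derivative test suffices. The case `K = 1` needs the
  -- most: `3 · 1.129 + 1 = 4.387` times `λ^(-1/2)`.
  rcases lt_or_ge (f₁ a - f₁ b) 1 with hD | hD
  · have hK2 : K < 2 := by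
      have : (K : ℝ) < 2 := by linarith
      exact_mod_cast this
    interval_cases K
    · have e1 := hlow.trans (tailBound_le _ _)
      have e2 := hupp.trans (tailBound_le _ _)
      simp only [Finset.range_zero, Finset.sum_empty]
      linarith
    · have e1 := (hbd 0 one_pos).2
      have e3 : ‖phaseIntegral f a b 0‖ + ‖phaseIntegral f a b (1 + 1 : ℕ)‖ ≤
          2 / √(π * lam) + 2 / π := by
        rw [Nat.cast_one] at hupp
        -- The distances from `f₁ b` to `0` and from `f₁ a` to `2` add up to more than 1, so one of
        -- them is at least `1/2`.
        rcases le_total (1 / 2) (f₁ b) with hh | hh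
        · have := tailBound_le_of_pos lam (show 0 < f₁ b by linarith)
          have h2 : 1 / (π * f₁ b) ≤ 2 / π := by
            rw [div_le_div_iff₀ (by positivity) pi_pos]
            nlinarith
          linarith [hupp.trans (tailBound_le _ _)]
        · have hpos : 1 / 2 ≤ 1 - (f₁ a - 1) := by linarith
          have := tailBound_le_of_pos lam (show 0 < 1 - (f₁ a - 1) by linarith)
          have h2 : 1 / (π * (1 - (f₁ a - 1))) ≤ 2 / π := by
            rw [div_le_div_iff₀ (by positivity) pi_pos]
            nlinarith
          linarith [hlow.trans (tailBound_le _ _), hupp.trans (this.trans h2)]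
      have e4 : 2 / π = 2 * (1 / π) := by ring
      have e5 : ‖phaseIntegral f a b (0 + 1 : ℕ) - main 0‖ ≤
          2 * (2 / √(π * lam)) + 1 / √lam := by
        simpa [hmain] using e1
      rw [Finset.sum_range_one]
      linarith
  · obtain ⟨K', rfl⟩ : ∃ K', K = K' + 1 := by
      refine Nat.exists_eq_succ_of_ne_zero ?_
      rintro rfl
      norm_num at hK'
      linarith
    set E := min (1.223 * (r / lam)) (2 * (2 / √(π * lam)) + 1 / √lam) with hE
    have hE0 : 0 ≤ E := le_min (by positivity) (by positivity)
    have hterm : ∀ i ∈ Finset.range (K' + 1), ‖phaseIntegral f a b (i + 1 : ℕ) - main i‖ ≤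
        E + (tailBound lam (f₁ a - (i + 1)) + tailBound lam (i + 1 - f₁ b)) := by
      intro i hi
      obtain ⟨h1, h2⟩ := hbd i (Finset.mem_range.1 hi)
      have hnn : ∀ x, 0 ≤ tailBound lam x := fun x => by
        rw [tailBound]
        split_ifs <;> positivity
      have := hnn (f₁ a - (i + 1))
      have := hnn (i + 1 - f₁ b)
      have hcast : ((i + 1 : ℕ) : ℤ) = (i : ℤ) + 1 := by push_cast; ring
      simp only [hmain, hcast]
      rcases min_choice (1.223 * (r / lam)) (2 * (2 / √(π * lam)) + 1 / √lam) with h | h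
      · rw [hE, h]; exact h1
      · rw [hE, h]; linarith
    have hsum := Finset.sum_le_sum hterm
    rw [Finset.sum_add_distrib, Finset.sum_add_distrib, Finset.sum_const, Finset.card_range,
      nsmul_eq_mul] at hsum
    have hsb := sum_tailBound_le lam K' hb1.le
    have hsa : ∑ i ∈ Finset.range (K' + 1), tailBound lam (f₁ a - (i + 1)) ≤
        tailBound lam (f₁ a - (K' + 1 : ℕ)) + 1 / π * (1 + Real.log K') := by
      have h := sum_tailBound_le lam K' (y := 1 - (f₁ a - (K' + 1 : ℕ))) (by linarith)
      rw [sub_sub_cancel, ← Finset.sum_range_reflect] at h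
      refine le_of_eq_of_le (Finset.sum_congr rfl fun i hi => ?_) h
      have : K' + 1 - 1 - i = K' - i := by omega
      rw [this, Nat.cast_sub (by have := Finset.mem_range.1 hi; omega)]
      congr 1
      push_cast
      ring
    have hlogK' : 1 / π * (1 + Real.log K') ≤ 1 / π + 1 / π * ℓ := by
      rw [mul_add, mul_one]
      gcongr
      rcases Nat.eq_zero_or_pos K' with rfl | hpos
      · simpa using hℓ0
      · refine (Real.log_le_log (by exact_mod_cast hpos) ?_).trans hlogK
        push_cast
        linarith
    -- The pairs are the frequencies `0, 1` around `f₁ b` and `K, K + 1` around `f₁ a`. Of the `5/π`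
    -- before the logarithm, `3/π` comes from Poisson summation and `1/π` from the tails at each
    -- endpoint.
    have ht1 := tailBound_add_one_sub_le lam (f₁ b)
    have ht2 := tailBound_add_one_sub_le lam (f₁ a - (K' + 1 : ℕ))
    have hfin := stationary_error_sum_le (K := K' + 1) (D := f₁ a - f₁ b) (E := E) hlam (min_le_left _ _)
      (min_le_right _ _) hE0 hD (by linarith) hk hh hr
    have e4 : 2 / π = 2 * (1 / π) := by ring
    rw [e4] at ht1 ht2
    linarith

end Global

/-! ### Extension to the line and the theorem -/

lemma exists_hasDerivAt_extension {g G' : ℝ → ℝ} {a b : ℝ} (hG' : Continuous G')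
    (hg : ∀ x ∈ Icc a b, HasDerivWithinAt g (G' x) (Icc a b) x) :
    ∃ G : ℝ → ℝ, (∀ x, HasDerivAt G (G' x) x) ∧ ∀ x ∈ Icc a b, G x = g x := by
  have hG : ∀ x, HasDerivAt (fun x => g a + ∫ t in a..x, G' t) (G' x) x := fun x =>
    (intervalIntegral.integral_hasDerivAt_right (hG'.intervalIntegrable a x)
      hG'.aestronglyMeasurable.stronglyMeasurableAtFilter hG'.continuousAt).const_add _
  refine ⟨fun x => g a + ∫ t in a..x, G' t, hG, fun x hx => ?_⟩
  have hsub : Icc a x ⊆ Icc a b := Icc_subset_Icc_right hx.2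
  have h := norm_sub_le_sub_of_norm_deriv_le (H := fun x => (g a + ∫ t in a..x, G' t) - g x)
    (H' := fun _ => 0) (B := fun _ => 0) (B' := fun _ => 0) hx.1
    (fun y hy => ((hG y).continuousAt.continuousWithinAt).sub
      ((hg y (hsub hy)).continuousWithinAt.mono hsub)) continuousOn_const
    (fun y hy => by
      have h1 := (hg y (hsub (Ioo_subset_Icc_self hy))).hasDerivAt
        (Icc_mem_nhds hy.1 (hy.2.trans_le hx.2))
      exact ((hG y).sub h1).congr_deriv (sub_self _))
    (fun y _ => hasDerivAt_const y 0) (fun y _ => by simp)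
  simp only [intervalIntegral.integral_same, add_zero, sub_self, sub_zero, norm_le_zero_iff] at h
  linarith

/-- Raised to the power `3/2` and squared, this is `0.969³ π² ≤ 9`. -/
lemma three_div_pi_rpow_two_thirds_ge : (0.969 : ℝ) ≤ 3 ^ (2 / 3 : ℝ) / π ^ (2 / 3 : ℝ) := by
  rw [← div_rpow (by norm_num) pi_pos.le]
  have h1 : (0.969 : ℝ) = ((0.969 : ℝ) ^ (3 / 2 : ℝ)) ^ (2 / 3 : ℝ) := by
    rw [← rpow_mul (by norm_num)]; norm_num
  rw [h1]
  refine rpow_le_rpow (by positivity) ?_ (by norm_num)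
  have h2 : ((0.969 : ℝ) ^ (3 / 2 : ℝ)) ^ 2 = 0.969 ^ 3 := by
    rw [← rpow_natCast, ← rpow_mul (by norm_num), ← rpow_natCast]
    norm_num
  refine (pow_le_pow_iff_left₀ (by positivity) (by positivity) two_ne_zero).1 ?_
  rw [h2, div_pow, le_div_iff₀ (by positivity)]
  have h3 : π ^ 2 ≤ 3.1416 ^ 2 := pow_le_pow_left₀ pi_pos.le (by have := pi_lt_d4; linarith) 2
  norm_num at h3 ⊢
  linarith

/-- `f₁, f₂, f₃` are the first, second and third derivatives of `f` on `[a, b]` (one-sided at the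
endpoints). For integers `n` and real `u, v`, `n ∈ Finset.Ioc ⌊u⌋ ⌊v⌋` says exactly `u < n ≤ v`. -/
theorem mainTheorem2 (f f₁ f₂ f₃ : ℝ → ℝ) (a b α β lam₂ lam₃ h₂ h₃ : ℝ) (hab : a < b)
    (hf₁ : ∀ x ∈ Icc a b, HasDerivWithinAt f (f₁ x) (Icc a b) x)
    (hf₂ : ∀ x ∈ Icc a b, HasDerivWithinAt f₁ (f₂ x) (Icc a b) x)
    (hf₃ : ∀ x ∈ Icc a b, HasDerivWithinAt f₂ (f₃ x) (Icc a b) x)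
    (hanti : AntitoneOn f₁ (Icc a b))
    (hα : f₁ b = α) (hβ : f₁ a = β)
    (hlam₂ : 0 < lam₂) (hlam₃ : 0 ≤ lam₃)
    (hb₂ : ∀ x ∈ Icc a b, lam₂ ≤ |f₂ x| ∧ |f₂ x| ≤ h₂ * lam₂)
    (hb₃ : ∀ x ∈ Icc a b, |f₃ x| ≤ h₃ * lam₃) :
    (∀ ν : ℤ, α < ν → ν ≤ β → ∃! y : ℝ, y ∈ Icc a b ∧ f₁ y = ν) ∧
    ∀ x : ℤ → ℝ, (∀ ν : ℤ, α < ν → ν ≤ β → x ν ∈ Icc a b ∧ f₁ (x ν) = ν) →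
      ‖(∑ n ∈ Finset.Ioc ⌊a⌋ ⌊b⌋, eChar (f n)) -
          ∑ ν ∈ Finset.Ioc ⌊α⌋ ⌊β⌋,
            eChar (f (x ν) - ν * x ν - 1 / 8) / ((√|f₂ (x ν)| : ℝ) : ℂ)‖ ≤
        4.686 / √lam₂ +
          2 * (3 : ℝ) ^ (2 / 3 : ℝ) / π ^ (2 / 3 : ℝ) * h₂ * h₃ ^ (1 / 3 : ℝ) * (b - a) *
            lam₃ ^ (1 / 3 : ℝ) +
          5 / π * Real.log (β - α + 2) + 6 := by
  have hba : b ∈ Icc a b := right_mem_Icc.2 hab.le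
  have haa : a ∈ Icc a b := left_mem_Icc.2 hab.le
  have hnonpos : ∀ x ∈ Icc a b, f₂ x ≤ 0 := fun x hx =>
    (hf₂ x hx).nonpos_of_antitoneOn ((uniqueDiffOn_Icc hab x hx).accPt) hanti
  have hneg : ∀ x ∈ Icc a b, f₂ x ≤ -lam₂ := fun x hx => by
    have h1 := (hb₂ x hx).1
    rw [abs_of_nonpos (hnonpos x hx)] at h1
    linarith
  -- extension of the phase to the real line
  set q : ℝ → ℝ := fun x => -f₂ (projIcc a b hab.le x) with hqdef
  have hf₂c : ContinuousOn f₂ (Icc a b) := fun x hx => (hf₃ x hx).continuousWithinAt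
  have hqc : Continuous q := (hf₂c.comp_continuous (by fun_prop) fun x => (projIcc a b hab.le x).2).neg
  have hqI : ∀ x ∈ Icc a b, q x = -f₂ x := fun x hx => by
    simp only [hqdef, projIcc_of_mem hab.le hx]
  have hqlam : ∀ x, lam₂ ≤ q x := fun x => by
    have := hneg _ (projIcc a b hab.le x).2
    simp only [hqdef]
    linarith
  have hM0 : 0 ≤ h₃ * lam₃ := (abs_nonneg _).trans (hb₃ a haa)
  set r := (h₃ * lam₃) ^ (1 / 3 : ℝ) with hr
  have hr0 : 0 ≤ r := rpow_nonneg hM0 _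
  have hr3 : r ^ 3 = h₃ * lam₃ := by
    rw [hr, ← rpow_natCast, ← rpow_mul hM0]
    norm_num
  -- The extension of `f''` need not be differentiable: a Lipschitz bound is enough, and projection
  -- onto `[a, b]` does not increase distances.
  have hLip : ∀ x y, |q x - q y| ≤ r ^ 3 * |x - y| := fun x y => by
    have h1 := (convex_Icc a b).norm_image_sub_le_of_norm_hasDerivWithin_le hf₃ hb₃
      (projIcc a b hab.le x).2 (projIcc a b hab.le y).2
    have h2 := abs_projIcc_sub_projIcc hab.le (c := y) (d := x)
    rw [hr3]
    simp only [norm_eq_abs] at h1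
    have h3 : |q x - q y| = |f₂ (projIcc a b hab.le y) - f₂ (projIcc a b hab.le x)| := by
      simp only [hqdef]
      congr 1
      ring
    rw [h3, abs_sub_comm x y]
    exact h1.trans (mul_le_mul_of_nonneg_left h2 hM0)
  obtain ⟨F₁, hF₁, hF₁I⟩ := exists_hasDerivAt_extension (g := f₁) (G' := fun x => -q x) hqc.neg
    fun x hx => by rw [hqI x hx, neg_neg]; exact hf₂ x hx
  have hF₁c : Continuous F₁ := continuous_iff_continuousAt.2 fun x => (hF₁ x).continuousAt
  obtain ⟨F, hF, hFI⟩ := exists_hasDerivAt_extension (g := f) hF₁c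
    fun x hx => by rw [hF₁I x hx]; exact hf₁ x hx
  have hFa : F₁ a = β := (hF₁I a haa).trans hβ
  have hFb : F₁ b = α := (hF₁I b hba).trans hα
  have hstrict : ∀ x y, lam₂ * (y - x) ≤ F₁ x - F₁ y ∨ y < x := fun x y => by
    rcases le_or_gt x y with h | h
    · exact Or.inl (sub_ge_of_deriv_le hF₁ hqlam h)
    · exact Or.inr h
  have hinj : ∀ x y, F₁ x = F₁ y → x = y := by
    have : ∀ x y, F₁ x = F₁ y → y ≤ x := fun x y hxy => by
      rcases hstrict x y with h | h
      · rw [hxy, sub_self] at h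
        by_contra hlt
        nlinarith
      · exact h.le
    exact fun x y hxy => le_antisymm (this y x hxy.symm) (this x y hxy)
  refine ⟨fun ν hν hν' => ?_, fun x hx => ?_⟩
  · have hcont : ContinuousOn f₁ (Icc a b) := fun x hx => (hf₂ x hx).continuousWithinAt
    obtain ⟨y, hy, hyν⟩ := intermediate_value_Icc' hab.le hcont
      (show (ν : ℝ) ∈ Icc (f₁ b) (f₁ a) by rw [hα, hβ]; exact ⟨hν.le, hν'⟩)
    refine ⟨y, ⟨hy, hyν⟩, fun z hz => hinj z y ?_⟩
    rw [hF₁I z hz.1, hF₁I y hy, hz.2, hyν]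
  · have hαβ : α ≤ β := by rw [← hα, ← hβ]; exact hanti haa hba hab.le
    -- Subtracting `kx` brings the derivative at `b` into `[0, 1)` and leaves `e(f(n))` unchanged;
    -- the frequencies become `ν = k + 1 + i` with `i < K`.
    set k := ⌊α⌋ with hk
    have hk1 := Int.floor_le α
    have hk2 := Int.lt_floor_add_one α
    set K := ⌊β - k⌋₊ with hKdef
    have hβk : 0 ≤ β - k := by linarith
    have hK1 := Nat.floor_le hβk
    have hK2 := Nat.lt_floor_add_one (β - k)
    have hKβ : (K : ℤ) = ⌊β⌋ - k := by
      rw [hKdef, Int.natCast_floor_eq_floor hβk, Int.floor_sub_intCast]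
    have hc : ∀ i < K, x (k + 1 + i) ∈ Icc a b ∧ f₁ (x (k + 1 + i)) = ((k + 1 + i : ℤ) : ℝ) := by
      intro i hi
      have hi' : (i : ℝ) + 1 ≤ K := by exact_mod_cast hi
      have hi0 : (0 : ℝ) ≤ i := Nat.cast_nonneg i
      exact hx _ (by push_cast; linarith) (by push_cast; linarith)
    -- Multiplied by the error `r/λ₂` per frequency, this loses its `λ₂` and becomes `h₂ r (b - a)`.
    have hD : β - α ≤ h₂ * lam₂ * (b - a) := by
      have h := (convex_Icc a b).norm_image_sub_le_of_norm_hasDerivWithin_le hf₂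
        (fun x hx => (hb₂ x hx).2) hba haa
      rw [hα, hβ, norm_eq_abs, norm_eq_abs, abs_of_nonneg (by linarith),
        abs_of_nonpos (by linarith)] at h
      linarith
    have key := norm_sum_eChar_sub_sum_stationary_le (f := fun x => F x - k * x)
      (f₁ := fun x => F₁ x - k) (q := q) (a := a) (b := b) (h := h₂ * lam₂ * (b - a)) (K := K)
      (fun x => (hF x).sub_int_mul k) (fun x => (hF₁ x).sub_const _) hlam₂ hqlam hqc hr0 hLip hab.le
      (by rw [hFb]; linarith) (by rw [hFb]; linarith) three_div_pi_rpow_two_thirds_ge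
      (by rw [hFa, hFb]; linarith) (by rw [hFa]; exact hK1) (by rw [hFa]; exact hK2)
      (fun i => x (k + 1 + i)) (fun i hi => by
        refine ⟨(hc i hi).1, ?_⟩
        rw [hF₁I _ (hc i hi).1, (hc i hi).2]
        push_cast
        ring)
    have hsum1 : ∑ n ∈ Finset.Ioc ⌊a⌋ ⌊b⌋, eChar (F n - k * n) =
        ∑ n ∈ Finset.Ioc ⌊a⌋ ⌊b⌋, eChar (f n) := by
      refine Finset.sum_congr rfl fun n hn => ?_
      rw [Finset.mem_Ioc, Int.floor_lt, Int.le_floor] at hn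
      rw [hFI n ⟨hn.1.le, hn.2⟩, ← Int.cast_mul, eChar_sub_int]
    have hsum2 : ∑ i ∈ Finset.range K, eChar (F (x (k + 1 + i)) - k * x (k + 1 + i) -
        (i + 1) * x (k + 1 + i) - 1 / 8) / (√(q (x (k + 1 + i))) : ℝ) =
        ∑ ν ∈ Finset.Ioc k ⌊β⌋, eChar (f (x ν) - ν * x ν - 1 / 8) / ((√|f₂ (x ν)| : ℝ) : ℂ) := by
      refine Finset.sum_bij' (fun i _ => k + 1 + (i : ℤ)) (fun ν _ => (ν - k - 1).toNat)
        ?_ ?_ ?_ ?_ ?_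
      · intro i hi
        rw [Finset.mem_range] at hi
        rw [Finset.mem_Ioc]
        omega
      · intro ν hν
        rw [Finset.mem_Ioc] at hν
        rw [Finset.mem_range]
        omega
      · intro i hi
        omega
      · intro ν hν
        rw [Finset.mem_Ioc] at hν
        omega
      · intro i hi
        have hmem := (hc i (Finset.mem_range.1 hi)).1
        rw [hFI _ hmem, hqI _ hmem, abs_of_nonpos (hnonpos _ hmem)]
        congr 2
        push_cast
        ring
    rw [hsum1, hsum2, hFa, hFb] at key
    refine key.trans (le_of_eq ?_)
    have hrr : r = h₃ ^ (1 / 3 : ℝ) * lam₃ ^ (1 / 3 : ℝ) := by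
      -- If `λ₃ = 0`, nothing forces `h₃ ≥ 0`, so the power cannot be split by multiplicativity;
      -- both sides are then zero.
      rcases hlam₃.eq_or_lt with h | h
      · rw [hr, ← h, mul_zero, zero_rpow (by norm_num), mul_zero]
      · exact mul_rpow (nonneg_of_mul_nonneg_left hM0 h) hlam₃
    rw [hrr, show β - k - (α - k) + 2 = β - α + 2 by ring]
    field_simp
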